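/- **Notation.** Sequences are finite; $s\preceq t$ (resp. $s\prec t$) means that $s$ is an initial (resp. proper initial) segment of $t$; $s^\frown t$ is concatenation; $MAX(S)$ is the set of $\prec$-maximal members of a set $S$ of sequences; $\Pi S=\{(s,t)\in S\times S: s\preceq t\in MAX(S)\}$. For an ordinal $\zeta$ and a sequence $t=(\zeta_i)_i$ of ordinals, $\zeta+t=(\zeta+\zeta_i)_i$; for a sequence of pairs $t=(\zeta_i,U_i)_i$, $\zeta+t=(\zeta+\zeta_i,U_i)_i$. *Trees.* Sets $\Gamma_\xi$ of sequences of ordinals are defined by recursion on $\xi$: $\Gamma_0=\{(0)\}$; $\Gamma_{\xi,1}=\Gamma_\xi$, $\Gamma_{\xi,n+1}=(\omega^\xi n+\Gamma_\xi)\cup\{t^\frown u: t\in MAX(\omega^\xi n+\Gamma_\xi),\ u\in\Gamma_{\xi,n}\}$, $\Gamma_{\xi+1}=\bigcup_{n\ge1}\Gamma_{\xi,n}$; and $\Gamma_\xi=\bigcup_{\zeta<\xi}(\omega^\zeta+\Gamma_{\zeta+1})$ for $\xi$ a limit ordinal. Fix a directed set $D$. Let $\Omega_\xi$ (resp. $\Omega_{\xi,n}$)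 be the set of all sequences of pairs $(\zeta_i,U_i)_i$ with $U_i\in D$ and $(\zeta_i)_i\in\Gamma_\xi$ (resp. $\Gamma_{\xi,n}$). *Levels and units.* A member of $\Omega_{\xi,n}$ is on level $m$ ($1\le m\le n$) if its sequence of ordinals is $(\omega^\xi(n-1)+t_1)^\frown\cdots^\frown(\omega^\xi(n-m)+t_m)$ with all $t_i\in\Gamma_\xi$ and $t_i\in MAX(\Gamma_\xi)$ for $i<m$. Let $\Lambda_{\xi,n,m}$ be the set of members on level $m$. A unit of $\Omega_{\xi,n}$ is a set $\{\omega^\xi(n-1)+r: r\in\Omega_\xi\}$, or $\{s^\frown(\omega^\xi(n-m-1)+r): r\in\Omega_\xi\}$ with $1\le m<n$ and $s\in MAX(\Lambda_{\xi,n,m})$. The map $\iota_{\xi,n}:\Omega_{\xi,n}\to\Omega_\xi$ sends each of the displayed members of a unit to $r$. *Weights.* $\mathbb P_\xi:\Omega_\xi\to[0,1]$ is defined by recursion: $\mathbb P_0\equiv1$; $\mathbb P_{\xi+1}(t)=\frac1n\mathbb P_\xi(\iota_{\xi,n}(t))$ for $t\in\Omega_{\xi,n}$; and, for $\xi$ a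 limit ordinal, $\mathbb P_\xi(\omega^\zeta+r)=\mathbb P_{\zeta+1}(r)$ for $\zeta<\xi$ and $r\in\Omega_{\zeta+1}$. *Prunings.* An extended pruning $(\theta,e)$ of $\Omega_{\xi,n}$ consists of $\theta:\Omega_{\xi,n}\to\Omega_{\xi,n}$ and $e:MAX(\Omega_{\xi,n})\to MAX(\Omega_{\xi,n})$ such that $s\prec s'$ implies $\theta(s)\prec\theta(s')$; if $(\zeta,U)$ and $(\zeta',U')$ are the last terms of $s$ and $\theta(s)$ then $U\le_D U'$; and $\theta(t)\preceq e(t)$ for every $t\in MAX(\Omega_{\xi,n})$. It is unit preserving if the image under $\theta$ of every unit is contained in a single unit, and $\theta(s),\theta(t)$ lie on different levels whenever $s\prec t$ lie on different levels. **Theorem.** Let $D$ be a directed set, $\xi$ an ordinal and $n\ge1$ an integer. (A) For every $\delta\in(0,1)$ and every $f:\Pi\Omega_{\xi,n}\to[-1,1]$ there exist a unit preserving extended pruning $(\theta,e)$ of $\Omega_{\xi,n}$ and numbers $a_1,\dots,a_n\in[-1,1]$ such that for each $1\le i\le n$: 1. $f(\theta(s),e(t))\ge a_i-\delta$ whenever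 $s\in\Lambda_{\xi,n,i}$, $t\in MAX(\Omega_{\xi,n})$ and $s\preceq t$; 2. for every $t\in MAX(\Omega_{\xi,n})$, $$\sum_{\Lambda_{\xi,n,i}\ni s\preceq e(t)}\mathbb P_\xi(\iota_{\xi,n}(s))\,f(s,e(t))\le \frac{\delta}{n}+a_i .$$ In particular, for every $t\in MAX(\Omega_{\xi,n})$, $\sum_{s\preceq e(t)}\mathbb P_\xi(\iota_{\xi,n}(s))f(s,e(t))\le\delta+\sum_{i=1}^n a_i$, the sum being over the $s\in\Omega_{\xi,n}$ with $s\preceq e(t)$. (B) Consequently, if $b<b_1$ are real numbers and $f:\Pi\Omega_{\xi,n}\to\mathbb R$ is bounded with $\sum_{s\preceq t}\mathbb P_\xi(\iota_{\xi,n}(s))f(s,t)\ge b_1$ for every $t\in MAX(\Omega_{\xi,n})$, then there exist a unit preserving extended pruning $(\theta,e)$ of $\Omega_{\xi,n}$ and real numbers $a_1,\dots,a_n$ with $\sum_{i=1}^n a_i>b$ such that $f(\theta(s),e(t))\ge a_i$ whenever $s\in\Lambda_{\xi,n,i}$, $t\in MAX(\Omega_{\xi,n})$ and $s\preceq t$.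 -/

import Mathlib

universe u v

namespace BTree

open Ordinal

/-! ### Finite sequences, maximal members, pairs -/

/-- Proper initial segment: `s ≺ t`. -/
def Precedes {α : Type*} (s t : List α) : Prop := s <+: t ∧ s ≠ t

/-- `MAX(S)`: the members of `S` with no proper extension in `S`. -/
def MAX {α : Type*} (S : Set (List α)) : Set (List α) :=
  {t | t ∈ S ∧ ∀ w ∈ S, ¬ Precedes t w}

/-- `Π S`: the pairs `(s, t)` of members of `S` with `s ⪯ t ∈ MAX(S)`. -/
def PiSet {α : Type*} (S : Set (List α)) : Set (List α × List α) :=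
  {p | p.1 ∈ S ∧ p.2 ∈ MAX S ∧ p.1 <+: p.2}

/-- `S D`: the sequences of pairs `(ζᵢ, Uᵢ)` with `(ζᵢ) ∈ S` and `Uᵢ ∈ D`. -/
def withLabels {L : Type*} (S : Set (List L)) (D : Type*) : Set (List (L × D)) :=
  {t | t.map Prod.fst ∈ S}

/-- `ζ + t` for a sequence of ordinals `t`. -/
def shift (ζ : Ordinal.{u}) (t : List Ordinal.{u}) : List Ordinal.{u} :=
  t.map fun x => ζ + x

/-- `ζ + t` for a sequence `t` of pairs: only the ordinals are translated. -/
def shiftD {D : Type v} (ζ : Ordinal.{u}) (t : List (Ordinal.{u} × D)) :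
    List (Ordinal.{u} × D) :=
  t.map fun p => (ζ + p.1, p.2)

/-! ### The trees `Γ_ξ`, `Γ_{ξ,n}`, `Ω_ξ`, `Ω_{ξ,n}` -/

/-- With `a = ω ^ ξ` and `G = Γ_ξ` this is `Γ_{ξ,n}`; for `n = 1` the second part is empty and
the set is `0 + G = G`. The value at `n = 0` is the empty set. -/
def stack (a : Ordinal.{u}) (G : Set (List Ordinal.{u})) : ℕ → Set (List Ordinal.{u})
  | 0 => ∅
  | n + 1 => shift (a * (n : Ordinal.{u})) '' G ∪
      {w | ∃ t ∈ MAX (shift (a * (n : Ordinal.{u})) '' G), ∃ r ∈ stack a G n, w = t ++ r}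

/-- `Γ_ξ`, by transfinite recursion. -/
noncomputable def Gamma (ξ : Ordinal.{u}) : Set (List Ordinal.{u}) :=
  Ordinal.limitRecOn (motive := fun _ => Set (List Ordinal.{u})) ξ
    {[0]}
    (fun ζ G => {t | ∃ n : ℕ, 1 ≤ n ∧ t ∈ stack (ω ^ ζ) G n})
    (fun η hη G => {t | ∃ (ζ : Ordinal.{u}) (h : ζ < η),
      ∃ r ∈ G (Order.succ ζ) (hη.succ_lt h), t = shift (ω ^ ζ) r})

/-- `Γ_{ξ,n}`. -/
noncomputable def GammaN (ξ : Ordinal.{u}) (n : ℕ) : Set (List Ordinal.{u}) :=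
  stack (ω ^ ξ) (Gamma ξ) n

theorem Gamma_zero : Gamma (0 : Ordinal.{u}) = {[0]} := by
  simp [Gamma]

theorem Gamma_add_one (ξ : Ordinal.{u}) :
    Gamma (ξ + 1) = {t | ∃ n : ℕ, 1 ≤ n ∧ t ∈ GammaN ξ n} := by
  simp [Gamma, GammaN]

theorem Gamma_limit {ξ : Ordinal.{u}} (hξ : Order.IsSuccLimit ξ) :
    Gamma ξ = {t | ∃ ζ < ξ, ∃ r ∈ Gamma (ζ + 1), t = shift (ω ^ ζ) r} := by
  rw [Gamma, Ordinal.limitRecOn_limit _ _ _ _ hξ]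
  ext t
  simp only [Set.mem_ofPred_eq, exists_prop]
  rfl

/-- `Ω_ξ = Γ_ξ D`. -/
noncomputable def Omega (ξ : Ordinal.{u}) (D : Type v) : Set (List (Ordinal.{u} × D)) :=
  withLabels (Gamma ξ) D

/-- `Ω_{ξ,n} = Γ_{ξ,n} D`. -/
noncomputable def OmegaN (ξ : Ordinal.{u}) (n : ℕ) (D : Type v) :
    Set (List (Ordinal.{u} × D)) :=
  withLabels (GammaN ξ n) D

/-! ### Levels, units, the map `ι_{ξ,n}` -/

/-- The sequence `t` has the form
`(ω^ξ(n-1) + t₁) ⌢ ... ⌢ (ω^ξ(n-m) + t_m)` with all `tᵢ ∈ Γ_ξ` and `tᵢ ∈ MAX(Γ_ξ)` for `i < m`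
(`b i` is `t_{i+1}`). -/
def HasBlocks (ξ : Ordinal.{u}) (n m : ℕ) (t : List Ordinal.{u}) : Prop :=
  ∃ b : ℕ → List Ordinal.{u},
    (∀ i < m, b i ∈ Gamma ξ) ∧ (∀ i, i + 1 < m → b i ∈ MAX (Gamma ξ)) ∧
    t = (List.range m).flatMap fun i => shift (ω ^ ξ * ((n - (i + 1) : ℕ) : Ordinal.{u})) (b i)

/-- `Λ_{ξ,n,m}`: the members of `Ω_{ξ,n}` on level `m`. -/
def Level (ξ : Ordinal.{u}) (n m : ℕ) (D : Type v) : Set (List (Ordinal.{u} × D)) :=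
  {t | t ∈ OmegaN ξ n D ∧ 1 ≤ m ∧ m ≤ n ∧ HasBlocks ξ n m (t.map Prod.fst)}

/-- The members `s` from which a unit of `Ω_{ξ,n}` issues, with the coefficient `k` by which the
unit is translated: `s = ∅` and `k = n - 1`, or `s ∈ MAX(Λ_{ξ,n,m})`, `1 ≤ m < n`,
and `k = n - m - 1`. -/
def IsUnitBase {D : Type v} (ξ : Ordinal.{u}) (n k : ℕ) (s : List (Ordinal.{u} × D)) : Prop :=
  (s = [] ∧ k + 1 = n) ∨ ∃ m : ℕ, 1 ≤ m ∧ m + k + 1 = n ∧ s ∈ MAX (Level ξ n m D)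

/-- `U = {s ⌢ (ω^ξ k + r) : r ∈ Ω_ξ}` for some `s`, `k` as above. -/
def IsTreeUnit {D : Type v} (ξ : Ordinal.{u}) (n : ℕ) (U : Set (List (Ordinal.{u} × D))) : Prop :=
  ∃ (k : ℕ) (s : List (Ordinal.{u} × D)), IsUnitBase ξ n k s ∧
    U = {t | ∃ r ∈ Omega ξ D, t = s ++ shiftD (ω ^ ξ * (k : Ordinal.{u})) r}

/-- `r` is the copy in `Ω_ξ` of the member `t` of some unit of `Ω_{ξ,n}`. -/
def IsIota {D : Type v} (ξ : Ordinal.{u}) (n : ℕ) (t r : List (Ordinal.{u} × D)) : Prop :=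
  r ∈ Omega ξ D ∧ ∃ (k : ℕ) (s : List (Ordinal.{u} × D)), IsUnitBase ξ n k s ∧
    t = s ++ shiftD (ω ^ ξ * (k : Ordinal.{u})) r

open Classical in
/-- `ι_{ξ,n} : Ω_{ξ,n} → Ω_ξ`, given on each unit by `s ⌢ (ω^ξ k + r) ↦ r`; the choice is unique
(see `iota_eq`). The value outside the units is irrelevant. -/
noncomputable def iota {D : Type v} (ξ : Ordinal.{u}) (n : ℕ) (t : List (Ordinal.{u} × D)) :
    List (Ordinal.{u} × D) :=
  if h : ∃ r, IsIota ξ n t r then h.choose else []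

/-! ### The weights `ℙ_ξ` -/

open Classical in
/-- `ℙ_ξ : Ω_ξ → [0,1]`, by transfinite recursion: `1` on `Ω_0`; `ℙ_ξ(ι_{ξ,n}(t)) / n` for
`t ∈ Ω_{ξ,n} ⊆ Ω_{ξ+1}`; `ℙ_{ζ+1}(r)` for `t = ω^ζ + r`, `r ∈ Ω_{ζ+1}`, if `ξ` is a limit.
The choices are unique (see `P_add_one`, `P_limit`). The value outside `Ω_ξ` is irrelevant. -/
noncomputable def P {D : Type v} (ξ : Ordinal.{u}) : List (Ordinal.{u} × D) → ℝ :=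
  Ordinal.limitRecOn (motive := fun _ => List (Ordinal.{u} × D) → ℝ) ξ
    (fun _ => 1)
    (fun ζ p t =>
      if h : ∃ n : ℕ, 1 ≤ n ∧ t ∈ OmegaN ζ n D then
        1 / (h.choose : ℝ) * p (iota ζ h.choose t)
      else 0)
    (fun η hη p t =>
      if h : ∃ q : Set.Iio η × List (Ordinal.{u} × D),
          q.2 ∈ Omega (q.1.1 + 1) D ∧ t = shiftD (ω ^ q.1.1) q.2 then
        p (Order.succ h.choose.1.1) (hη.succ_lt h.choose.1.2) h.choose.2
      else 0)

/-! ### Extended prunings -/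

/-- `(θ, e) : S₁ → S₂` is an extended pruning, for sets `S₁`, `S₂` of sequences of pairs with
second entries in the directed set `D`. Only the values of `θ` on `S₁` and of `e` on `MAX(S₁)`
matter. -/
structure IsExtendedPruning {L₁ L₂ D : Type*} [Preorder D]
    (S₁ : Set (List (L₁ × D))) (S₂ : Set (List (L₂ × D)))
    (θ e : List (L₁ × D) → List (L₂ × D)) : Prop where
  mapsTo : Set.MapsTo θ S₁ S₂
  monotone : ∀ s ∈ S₁, ∀ s' ∈ S₁, Precedes s s' → Precedes (θ s) (θ s')
  label_le : ∀ (s₁ : List (L₁ × D)) (ζ : L₁) (U : D) (s₂ : List (L₂ × D)) (ζ' : L₂) (U' : D),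
    s₁ ++ [(ζ, U)] ∈ S₁ → θ (s₁ ++ [(ζ, U)]) = s₂ ++ [(ζ', U')] → U ≤ U'
  mapsTo_max : Set.MapsTo e (MAX S₁) (MAX S₂)
  prefix_max : ∀ t ∈ MAX S₁, θ t <+: e t

/-- `(θ, e) : Ω_{ξ,n} → Ω_{ξ,n}` is a unit preserving extended pruning. -/
structure IsUnitPreserving {D : Type v} [Preorder D] (ξ : Ordinal.{u}) (n : ℕ)
    (θ e : List (Ordinal.{u} × D) → List (Ordinal.{u} × D)) : Prop where
  extendedPruning : IsExtendedPruning (OmegaN ξ n D) (OmegaN ξ n D) θ e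
  unit_image : ∀ U : Set (List (Ordinal.{u} × D)), IsTreeUnit ξ n U →
    ∃ V : Set (List (Ordinal.{u} × D)), IsTreeUnit ξ n V ∧ Set.MapsTo θ U V
  level_ne : ∀ s t : List (Ordinal.{u} × D), Precedes s t →
    ∀ i j : ℕ, s ∈ Level ξ n i D → t ∈ Level ξ n j D → i ≠ j →
    ∀ k l : ℕ, θ s ∈ Level ξ n k D → θ t ∈ Level ξ n l D → k ≠ l

open Classical in
/-- `∑_{S ∋ s ⪯ t} g(s)`. -/
noncomputable def branchSum {α : Type*} (S : Set (List α)) (t : List α) (g : List α → ℝ) : ℝ :=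
  ∑ s ∈ t.inits.toFinset with s ∈ S, g s

/-! ### The choices in `ι_{ξ,n}` and `ℙ_ξ` are unique -/

theorem stack_prop {a : Ordinal.{u}} {G : Set (List Ordinal.{u})}
    (hG : ∀ t ∈ G, t ≠ [] ∧ ∀ x ∈ t, x < a) :
    ∀ (n : ℕ) (t : List Ordinal.{u}), t ∈ stack a G n →
      (∃ x l, t = x :: l ∧ x / a + 1 = (n : Ordinal.{u})) ∧ ∀ x ∈ t, x < a * (n : Ordinal.{u}) := by
  have key : ∀ (n : ℕ) (r : List Ordinal.{u}), r ∈ G →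
      (∃ x l, shift (a * (n : Ordinal.{u})) r = x :: l ∧ x / a + 1 = ((n + 1 : ℕ) : Ordinal.{u})) ∧
      ∀ x ∈ shift (a * (n : Ordinal.{u})) r, x < a * ((n + 1 : ℕ) : Ordinal.{u}) := by
    intro n r hr
    obtain ⟨h1, h2⟩ := hG r hr
    refine ⟨?_, ?_⟩
    · cases r with
      | nil => exact absurd rfl h1
      | cons y l =>
        have hy : y < a := h2 y (by simp)
        have ha : a ≠ 0 := (lt_of_le_of_lt (zero_le (a := y)) hy).ne'
        refine ⟨_, _, rfl, ?_⟩
        rw [Ordinal.mul_add_div _ ha, Ordinal.div_eq_zero_of_lt hy]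
        push_cast
        simp
    · intro x hx
      simp only [shift, List.mem_map] at hx
      obtain ⟨y, hy, rfl⟩ := hx
      push_cast
      rw [mul_add, mul_one]
      exact (add_lt_add_iff_left _).2 (h2 y hy)
  intro n
  induction n with
  | zero => intro t ht; exact absurd ht (by simp [stack])
  | succ n ih =>
    intro t ht
    rcases ht with ⟨r, hr, rfl⟩ | ⟨t, ⟨⟨r, hr, rfl⟩, -⟩, w, hw, rfl⟩
    · exact key n r hr
    · obtain ⟨⟨x, l, h1, h2⟩, h3⟩ := key n r hr
      refine ⟨⟨x, l ++ w, by rw [h1]; rfl, h2⟩, ?_⟩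
      intro y hy
      rcases List.mem_append.1 hy with hy | hy
      · exact h3 y hy
      · refine lt_of_lt_of_le ((ih w hw).2 y hy) ?_
        gcongr
        omega

theorem Gamma_prop (ξ : Ordinal.{u}) :
    ∀ t ∈ Gamma ξ, t ≠ [] ∧ ∀ x ∈ t, x < ω ^ ξ := by
  induction ξ using Ordinal.limitRecOn with
  | zero => intro t ht; rw [Gamma_zero] at ht; simp at ht; subst ht; simp
  | add_one ξ ih =>
    intro t ht
    rw [Gamma_add_one] at ht
    obtain ⟨n, -, hn⟩ := ht
    obtain ⟨⟨x, l, h1, -⟩, h2⟩ := stack_prop ih n t hn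
    refine ⟨by simp [h1], fun x hx => (h2 x hx).trans ?_⟩
    rw [← Order.succ_eq_add_one, Ordinal.opow_succ]
    exact mul_lt_mul_of_pos_left (Ordinal.natCast_lt_omega0 n)
      (Ordinal.opow_pos _ Ordinal.omega0_pos)
  | limit ξ hξ ih =>
    intro t ht
    rw [Gamma_limit hξ] at ht
    obtain ⟨ζ, hζ, r, hr, rfl⟩ := ht
    have hlt : ζ + 1 < ξ := hξ.succ_lt hζ
    obtain ⟨h1, h2⟩ := ih _ hlt r hr
    refine ⟨by simpa [shift] using h1, ?_⟩
    intro x hx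
    simp only [shift, List.mem_map] at hx
    obtain ⟨y, hy, rfl⟩ := hx
    refine Ordinal.isPrincipal_add_omega0_opow ξ ?_ ?_
    · exact (Ordinal.opow_lt_opow_iff_right Ordinal.one_lt_omega0).2 hζ
    · exact (h2 y hy).trans ((Ordinal.opow_lt_opow_iff_right Ordinal.one_lt_omega0).2 hlt)

theorem shiftD_injective {D : Type v} (ζ : Ordinal.{u}) :
    Function.Injective (shiftD ζ : List (Ordinal.{u} × D) → List (Ordinal.{u} × D)) := by
  apply List.map_injective_iff.2
  rintro ⟨a, U⟩ ⟨b, V⟩ h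
  simpa using h

theorem div_of_mem_shiftD {D : Type v} {ξ : Ordinal.{u}} {k : ℕ} {r : List (Ordinal.{u} × D)}
    (hr : r ∈ Omega ξ D) {p : Ordinal.{u} × D}
    (hp : p ∈ shiftD (ω ^ ξ * (k : Ordinal.{u})) r) : p.1 / ω ^ ξ = k := by
  simp only [shiftD, List.mem_map] at hp
  obtain ⟨q, hq, rfl⟩ := hp
  have hlt : q.1 < ω ^ ξ := (Gamma_prop ξ _ hr).2 _ (List.mem_map_of_mem hq)
  have hne : ω ^ ξ ≠ 0 := (Ordinal.opow_pos _ Ordinal.omega0_pos).ne'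
  rw [Ordinal.mul_add_div _ hne, Ordinal.div_eq_zero_of_lt hlt, add_zero]

theorem lt_div_of_mem_base {D : Type v} {ξ : Ordinal.{u}} {n k : ℕ} {s : List (Ordinal.{u} × D)}
    (hs : IsUnitBase ξ n k s) {p : Ordinal.{u} × D} (hp : p ∈ s) :
    (k : Ordinal.{u}) < p.1 / ω ^ ξ := by
  rcases hs with ⟨rfl, -⟩ | ⟨m, -, hm, ⟨-, -, -, b, hb, -, h⟩, -⟩
  · simp at hp
  · have hp' : p.1 ∈ s.map Prod.fst := List.mem_map_of_mem hp
    rw [h] at hp'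
    simp only [List.mem_flatMap, List.mem_range, shift, List.mem_map] at hp'
    obtain ⟨i, hi, y, hy, hpy⟩ := hp'
    have hlt : y < ω ^ ξ := (Gamma_prop ξ _ (hb i hi)).2 _ hy
    have hne : ω ^ ξ ≠ 0 := (Ordinal.opow_pos _ Ordinal.omega0_pos).ne'
    rw [← hpy, Ordinal.mul_add_div _ hne, Ordinal.div_eq_zero_of_lt hlt, add_zero]
    exact_mod_cast (by omega : k < n - (i + 1))

theorem IsIota.unique {D : Type v} {ξ : Ordinal.{u}} {n : ℕ} {t r r' : List (Ordinal.{u} × D)}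
    (h : IsIota ξ n t r) (h' : IsIota ξ n t r') : r = r' := by
  classical
  obtain ⟨hr, k, s, hs, rfl⟩ := h
  obtain ⟨hr', k', s', hs', he⟩ := h'
  have hne : ∀ {r : List (Ordinal.{u} × D)} (j : ℕ), r ∈ Omega ξ D →
      shiftD (ω ^ ξ * (j : Ordinal.{u})) r ≠ [] := by
    intro r j hr h0
    have h1 := (Gamma_prop ξ _ hr).1
    simp [shiftD] at h0
    simp [h0] at h1
  have hk : k = k' := by
    have h1 := hne k hr
    have h2 := hne k' hr'
    have e : (shiftD (ω ^ ξ * (k : Ordinal.{u})) r).getLast h1 =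
        (shiftD (ω ^ ξ * (k' : Ordinal.{u})) r').getLast h2 := by
      have g1 := List.getLast_append_of_ne_nil (l := s) (by simp [h1]) h1
      have g2 := List.getLast_append_of_ne_nil (l := s') (by simp [h2]) h2
      rw [← g1, ← g2]
      simp only [he]
    have d1 := div_of_mem_shiftD hr (List.getLast_mem h1)
    have d2 := div_of_mem_shiftD hr' (List.getLast_mem h2)
    rw [e, d2] at d1
    exact_mod_cast d1.symm
  subst hk
  have f : ∀ {s r : List (Ordinal.{u} × D)}, r ∈ Omega ξ D → IsUnitBase ξ n k s →
      (s ++ shiftD (ω ^ ξ * (k : Ordinal.{u})) r).filter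
        (fun p => decide (p.1 / ω ^ ξ = (k : Ordinal.{u}))) =
      shiftD (ω ^ ξ * (k : Ordinal.{u})) r := by
    intro s r hr hs
    rw [List.filter_append, List.filter_eq_nil_iff.2, List.filter_eq_self.2, List.nil_append]
    · intro p hp
      simpa using div_of_mem_shiftD hr hp
    · intro p hp
      simpa using (lt_div_of_mem_base hs hp).ne'
  apply shiftD_injective (ω ^ ξ * (k : Ordinal.{u}))
  rw [← f hr hs, he, f hr' hs']

theorem iota_eq {D : Type v} {ξ : Ordinal.{u}} {n k : ℕ} {s r : List (Ordinal.{u} × D)}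
    (hs : IsUnitBase ξ n k s) (hr : r ∈ Omega ξ D) :
    iota ξ n (s ++ shiftD (ω ^ ξ * (k : Ordinal.{u})) r) = r := by
  have h : IsIota ξ n (s ++ shiftD (ω ^ ξ * (k : Ordinal.{u})) r) r := ⟨hr, k, s, hs, rfl⟩
  have h' : ∃ r', IsIota ξ n (s ++ shiftD (ω ^ ξ * (k : Ordinal.{u})) r) r' := ⟨r, h⟩
  rw [iota, dif_pos h']
  exact h'.choose_spec.unique h

theorem P_zero {D : Type v} (t : List (Ordinal.{u} × D)) : P 0 t = 1 := by
  simp [P]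

theorem P_add_one {D : Type v} {ξ : Ordinal.{u}} {n : ℕ} (hn : 1 ≤ n)
    {t : List (Ordinal.{u} × D)} (ht : t ∈ OmegaN ξ n D) :
    P (ξ + 1) t = 1 / (n : ℝ) * P ξ (iota ξ n t) := by
  have h : ∃ n : ℕ, 1 ≤ n ∧ t ∈ OmegaN ξ n D := ⟨n, hn, ht⟩
  have e : h.choose = n := by
    obtain ⟨⟨x, l, h1, h2⟩, -⟩ := stack_prop (Gamma_prop ξ) n _ ht
    obtain ⟨⟨x', l', h1', h2'⟩, -⟩ := stack_prop (Gamma_prop ξ) _ _ h.choose_spec.2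
    rw [h1] at h1'
    simp only [List.cons.injEq] at h1'
    rw [← h1'.1, h2] at h2'
    exact_mod_cast h2'.symm
  rw [P, Ordinal.limitRecOn_add_one, dif_pos h, e]
  rfl

theorem P_limit {D : Type v} {ξ ζ : Ordinal.{u}} (hξ : Order.IsSuccLimit ξ) (hζ : ζ < ξ)
    {r : List (Ordinal.{u} × D)} (hr : r ∈ Omega (ζ + 1) D) :
    P ξ (shiftD (ω ^ ζ) r) = P (ζ + 1) r := by
  have h : ∃ q : Set.Iio ξ × List (Ordinal.{u} × D),
      q.2 ∈ Omega (q.1.1 + 1) D ∧ shiftD (ω ^ ζ) r = shiftD (ω ^ q.1.1) q.2 :=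
    ⟨(⟨ζ, hζ⟩, r), hr, rfl⟩
  have bound : ∀ {ζ : Ordinal.{u}} {r : List (Ordinal.{u} × D)}, r ∈ Omega (ζ + 1) D →
      ∀ p ∈ shiftD (ω ^ ζ) r, ω ^ ζ ≤ p.1 ∧ p.1 < ω ^ (ζ + 1) := by
    intro ζ r hr p hp
    simp only [shiftD, List.mem_map] at hp
    obtain ⟨q, hq, rfl⟩ := hp
    refine ⟨le_self_add, Ordinal.isPrincipal_add_omega0_opow (ζ + 1) ?_
      ((Gamma_prop _ _ hr).2 _ (List.mem_map_of_mem hq))⟩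
    exact (Ordinal.opow_lt_opow_iff_right Ordinal.one_lt_omega0).2 (lt_add_one ζ)
  have e : h.choose = (⟨ζ, hζ⟩, r) := by
    obtain ⟨hq, heq⟩ := h.choose_spec
    generalize h.choose = q at hq heq
    obtain ⟨⟨η, hη⟩, r'⟩ := q
    dsimp only at hq heq
    have hne : shiftD (ω ^ ζ) r ≠ [] := by
      intro h0
      have h1 := (Gamma_prop _ _ hr).1
      simp [shiftD] at h0
      simp [h0] at h1
    obtain ⟨p, hp⟩ := List.exists_mem_of_ne_nil _ hne
    obtain ⟨b1, b2⟩ := bound hr p hp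
    rw [heq] at hp
    obtain ⟨c1, c2⟩ := bound hq p hp
    have l1 := (Ordinal.opow_lt_opow_iff_right Ordinal.one_lt_omega0).1 (b1.trans_lt c2)
    have l2 := (Ordinal.opow_lt_opow_iff_right Ordinal.one_lt_omega0).1 (c1.trans_lt b2)
    have : η = ζ := le_antisymm (Order.lt_add_one_iff.1 l2) (Order.lt_add_one_iff.1 l1)
    subst this
    rw [shiftD_injective _ heq]
  rw [P, Ordinal.limitRecOn_limit _ _ _ _ hξ, dif_pos h]
  change P (h.choose.1.1 + 1) h.choose.2 = P (ζ + 1) r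
  rw [e]

end BTree

open BTree

namespace BTree

open Ordinal

/-! ### Prefixes and maximal members -/

section Lists

variable {α β : Type*}

/-! The values `f (θ s) (e t)` are compared with averages of `f` along the branch `e t` of the
original tree. A pruning therefore need not respect the weights, and may avoid the places where `f`
is too small. The engine is `Concentrates`, proved for every `ξ` by transfinite induction
(`concentrates`): it raises `f` above its branch averages, up to `δ`, and makes a given finite
colouring of the branches constant. The colouring keeps the induction running: real numbers attached
to branches are rounded (`exists_rounding`) and recorded as colours, so that after pruning they are
constant up to a small error.

Within Ω_{ξ,n} the induction is on `n` (`LevelConcentrates.succ`). Above each maximal `s` of the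
first level the remaining levels are pruned, with the values of `f` at the finitely many `r ⪯ s`
recorded in the colour. On the first level `f` then depends, up to an error, only on `r` and `s`,
and the hypothesis on Ω_ξ applies to it.

At a successor, the average over Ω_{ξ,n} is the mean of `n` level averages, each at most 1 and
nearly constant after pruning. A proportion of the levels bounded below independently of `n` is not
much worse than the mean (`mul_le_mul_count`); for large `n` there are at least `m` such levels, and
Ω_{ξ,m} is mapped into them (`exists_isPruning_OmegaN_of_le_count`). At a limit, each piece of the
tree is moved into a later piece. In both cases the target is chosen with a colour that occurs
cofinally (`exists_cofinal_color`), so that all pieces receive the same colour. At `ξ = 0` the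
average is `f` itself, and the cofinal colour comes from the directedness of `D`.

Assertion (A) is `Concentrates.level` with the rounded level averages as colours, `a i` being the
level average along one reference branch. Assertion (B) follows by scaling. -/

theorem mem_MAX_append_inj {S : Set (List α)} {t t' u u' : List α} (ht : t ∈ MAX S)
    (ht' : t' ∈ MAX S) (h : t ++ u <+: t' ++ u') : t = t' ∧ u <+: u' := by
  have h1 : t <+: t' ++ u' := (List.prefix_append t u).trans h
  have h2 : t' <+: t' ++ u' := List.prefix_append _ _
  have e : t = t' := by
    rcases List.prefix_or_prefix_of_prefix h1 h2 with h3 | h3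
    · by_contra hne
      exact ht.2 t' ht'.1 ⟨h3, hne⟩
    · by_contra hne
      exact ht'.2 t ht.1 ⟨h3, Ne.symm hne⟩
  subst e
  exact ⟨rfl, (List.prefix_append_right_inj t).1 h⟩

theorem eq_of_mem_MAX_prefix {S : Set (List α)} {t s : List α} (ht : t ∈ MAX S) (hs : s ∈ S)
    (h : t <+: s) : t = s := by
  by_contra hne
  exact ht.2 s hs ⟨h, hne⟩

theorem prefix_of_mem_MAX {S : Set (List α)} {t u s : List α} (ht : t ∈ MAX S) (hs : s ∈ S)
    (h : s <+: t ++ u) : s <+: t := by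
  rcases List.prefix_or_prefix_of_prefix h (List.prefix_append t u) with h3 | h3
  · exact h3
  · rw [eq_of_mem_MAX_prefix ht hs h3]

theorem append_notMem_of_mem_MAX {S : Set (List α)} {t u : List α} (ht : t ∈ MAX S) (hu : u ≠ []) :
    t ++ u ∉ S := by
  intro h
  have := eq_of_mem_MAX_prefix ht h (List.prefix_append t u)
  exact hu (by simpa using this)

theorem Precedes.append_left {s t : List α} (h : Precedes s t) (r : List α) :
    Precedes (r ++ s) (r ++ t) :=
  ⟨(List.prefix_append_right_inj r).2 h.1, fun e => h.2 (List.append_cancel_left e)⟩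

theorem Precedes.of_append_left {s t r : List α} (h : Precedes (r ++ s) (r ++ t)) :
    Precedes s t :=
  ⟨(List.prefix_append_right_inj r).1 h.1, fun e => h.2 (by rw [e])⟩

theorem Precedes.trans_prefix {s t r : List α} (h : Precedes s t) (h' : t <+: r) :
    Precedes s r := by
  refine ⟨h.1.trans h', ?_⟩
  rintro rfl
  exact h.2 (h.1.eq_of_length (le_antisymm h.1.length_le h'.length_le))

theorem precedes_append_of_prefix {s t u : List α} (h : s <+: t) (hu : u ≠ []) :
    Precedes s (t ++ u) := by
  refine ⟨h.trans (List.prefix_append _ _), ?_⟩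
  rintro rfl
  have := h.length_le
  simp only [List.length_append] at this
  exact hu (List.length_eq_zero_iff.1 (by omega))

theorem map_prefix_map_iff {φ : α → β} (hφ : Function.Injective φ) {s t : List α} :
    s.map φ <+: t.map φ ↔ s <+: t := by
  refine ⟨?_, fun h => h.map φ⟩
  intro h
  rw [List.prefix_iff_eq_take] at h ⊢
  rw [List.length_map, ← List.map_take] at h
  exact List.map_injective_iff.2 hφ h

theorem precedes_map_iff {φ : α → β} (hφ : Function.Injective φ) {s t : List α} :
    Precedes (s.map φ) (t.map φ) ↔ Precedes s t := by
  rw [Precedes, Precedes, map_prefix_map_iff hφ, (List.map_injective_iff.2 hφ).ne_iff]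

theorem MAX_image_map {φ : α → β} (hφ : Function.Injective φ) (S : Set (List α)) :
    MAX (List.map φ '' S) = List.map φ '' MAX S := by
  ext w
  constructor
  · rintro ⟨⟨t, ht, rfl⟩, h⟩
    exact ⟨t, ⟨ht, fun w hw hp => h _ ⟨w, hw, rfl⟩ ((precedes_map_iff hφ).2 hp)⟩, rfl⟩
  · rintro ⟨t, ⟨ht, h⟩, rfl⟩
    refine ⟨⟨t, ht, rfl⟩, ?_⟩
    rintro _ ⟨w, hw, rfl⟩ hp
    exact h w hw ((precedes_map_iff hφ).1 hp)

/-- The tree `S` with a copy of `T` attached to each member of `M`. -/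
def graft (S M T : Set (List α)) : Set (List α) := S ∪ Set.image2 (· ++ ·) M T

theorem MAX_image2_append {S T : Set (List α)} :
    MAX (Set.image2 (· ++ ·) (MAX S) T) = Set.image2 (· ++ ·) (MAX S) (MAX T) := by
  ext w
  constructor
  · rintro ⟨⟨t, ht, u, hu, rfl⟩, h⟩
    exact ⟨t, ht, u, ⟨hu, fun u' hu' hp => h _ ⟨t, ht, u', hu', rfl⟩ (hp.append_left t)⟩, rfl⟩
  · rintro ⟨t, ht, u, hu, rfl⟩
    refine ⟨⟨t, ht, u, hu.1, rfl⟩, ?_⟩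
    rintro _ ⟨t', ht', u', hu', rfl⟩ hp
    obtain ⟨rfl, -⟩ := mem_MAX_append_inj ht ht' hp.1
    exact hu.2 u' hu' hp.of_append_left

/-- Since `T` is nonempty and omits `[]`, every maximal member of `S` acquires a proper extension,
so only the attached copies contribute maximal members. -/
theorem MAX_graft {S T : Set (List α)} (hT : T.Nonempty) (hT0 : [] ∉ T) :
    MAX (graft S (MAX S) T) = Set.image2 (· ++ ·) (MAX S) (MAX T) := by
  rw [← MAX_image2_append]
  have hne : ∀ u ∈ T, u ≠ [] := fun u hu h => hT0 (h ▸ hu)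
  ext w
  constructor
  · rintro ⟨hw | hw, h⟩
    · obtain ⟨u, hu⟩ := hT
      have hw' : w ∈ MAX S := ⟨hw, fun w' hw' => h w' (Or.inl hw')⟩
      exact absurd (precedes_append_of_prefix (List.prefix_refl w) (hne u hu))
        (h _ (Or.inr ⟨w, hw', u, hu, rfl⟩))
    · exact ⟨hw, fun w' hw' => h w' (Or.inr hw')⟩
  · rintro ⟨⟨t, ht, u, hu, rfl⟩, h⟩
    refine ⟨Or.inr ⟨t, ht, u, hu, rfl⟩, ?_⟩
    rintro w' (hw' | hw') hp
    · exact ht.2 w' hw' ((precedes_append_of_prefix (List.prefix_refl t) (hne u hu)).trans_prefix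
        hp.1)
    · exact h w' hw' hp

/-- The hypothesis says that members of different pieces are incomparable, so maximality can be
tested within a piece. -/
theorem MAX_iUnion {ι : Type*} {S : ι → Set (List α)}
    (hS : ∀ i j, ∀ s ∈ S i, ∀ s' ∈ S j, s <+: s' → i = j) :
    MAX (⋃ i, S i) = ⋃ i, MAX (S i) := by
  ext w
  simp only [Set.mem_iUnion]
  constructor
  · rintro ⟨hw, h⟩
    obtain ⟨i, hi⟩ := Set.mem_iUnion.1 hw
    exact ⟨i, hi, fun w' hw' => h w' (Set.mem_iUnion.2 ⟨i, hw'⟩)⟩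
  · rintro ⟨i, hi, h⟩
    refine ⟨Set.mem_iUnion.2 ⟨i, hi⟩, fun w' hw' hp => ?_⟩
    obtain ⟨j, hj⟩ := Set.mem_iUnion.1 hw'
    obtain rfl := hS i j w hi w' hj hp.1
    exact h w' hj hp

/-! ### Sums along branches -/

theorem branchSum_congr {S S' : Set (List α)} {t : List α} {g g' : List α → ℝ}
    (hS : ∀ s, s <+: t → (s ∈ S ↔ s ∈ S')) (hg : ∀ s ∈ S, s <+: t → g s = g' s) :
    branchSum S t g = branchSum S' t g' := by
  classical
  unfold branchSum
  refine Finset.sum_congr ?_ ?_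
  · ext s
    simp only [Finset.mem_filter, List.mem_toFinset, List.mem_inits]
    exact ⟨fun h => ⟨h.1, (hS s h.1).1 h.2⟩, fun h => ⟨h.1, (hS s h.1).2 h.2⟩⟩
  · intro s hs
    simp only [Finset.mem_filter, List.mem_toFinset, List.mem_inits] at hs
    exact hg s ((hS s hs.1).2 hs.2) hs.1

theorem branchSum_mono {S : Set (List α)} {t : List α} {g g' : List α → ℝ}
    (hg : ∀ s ∈ S, s <+: t → g s ≤ g' s) : branchSum S t g ≤ branchSum S t g' := by
  refine Finset.sum_le_sum fun s hs => ?_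
  simp only [Finset.mem_filter, List.mem_toFinset, List.mem_inits] at hs
  exact hg s hs.2 hs.1

theorem branchSum_mul_left (S : Set (List α)) (t : List α) (x : ℝ) (g : List α → ℝ) :
    branchSum S t (fun s => x * g s) = x * branchSum S t g := by
  rw [branchSum, branchSum, Finset.mul_sum]

theorem branchSum_add (S : Set (List α)) (t : List α) (g g' : List α → ℝ) :
    branchSum S t (fun s => g s + g' s) = branchSum S t g + branchSum S t g' := by
  rw [branchSum, branchSum, branchSum, Finset.sum_add_distrib]

theorem branchSum_empty (t : List α) (g : List α → ℝ) : branchSum ∅ t g = 0 := by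
  simp [branchSum]

theorem branchSum_union {S T : Set (List α)} (h : Disjoint S T) (t : List α) (g : List α → ℝ) :
    branchSum (S ∪ T) t g = branchSum S t g + branchSum T t g := by
  classical
  unfold branchSum
  rw [← Finset.sum_union]
  · refine Finset.sum_congr ?_ fun _ _ => rfl
    ext s
    simp only [Finset.mem_filter, Finset.mem_union, Set.mem_union]
    tauto
  · rw [Finset.disjoint_left]
    intro s hs hs'
    exact Set.disjoint_left.1 h (Finset.mem_filter.1 hs).2 (Finset.mem_filter.1 hs').2

theorem branchSum_image {φ : List α → List β} {S : Set (List α)} {t : List α} {t' : List β}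
    (hφ : Function.Injective φ) (h : ∀ s ∈ S, φ s <+: t' ↔ s <+: t) (g : List β → ℝ) :
    branchSum (φ '' S) t' g = branchSum S t (fun s => g (φ s)) := by
  classical
  unfold branchSum
  symm
  refine Finset.sum_bij (fun s _ => φ s) ?_ (fun _ _ _ _ e => hφ e) ?_ fun _ _ => rfl
  · intro s hs
    simp only [Finset.mem_filter, List.mem_toFinset, List.mem_inits] at hs ⊢
    exact ⟨(h s hs.2).2 hs.1, s, hs.2, rfl⟩
  · intro w hw
    simp only [Finset.mem_filter, List.mem_toFinset, List.mem_inits] at hw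
    obtain ⟨hw, s, hs, rfl⟩ := hw
    refine ⟨s, ?_, rfl⟩
    simp only [Finset.mem_filter, List.mem_toFinset, List.mem_inits]
    exact ⟨(h s hs).1 hw, hs⟩

theorem branchSum_image2_append {S T : Set (List α)} {t u : List α} (ht : t ∈ MAX S)
    (g : List α → ℝ) :
    branchSum (Set.image2 (· ++ ·) (MAX S) T) (t ++ u) g =
      branchSum T u (fun s => g (t ++ s)) := by
  rw [← branchSum_image (φ := fun s => t ++ s) (t' := t ++ u)
    (fun _ _ e => List.append_cancel_left e) (fun s _ => List.prefix_append_right_inj t)]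
  refine branchSum_congr (fun s hs => ⟨?_, ?_⟩) fun _ _ _ => rfl
  · rintro ⟨t', ht', u', hu', rfl⟩
    obtain ⟨rfl, -⟩ := mem_MAX_append_inj ht' ht hs
    exact ⟨u', hu', rfl⟩
  · rintro ⟨u', hu', rfl⟩
    exact ⟨t, ht, u', hu', rfl⟩

theorem branchSum_iUnion {ι : Type*} {S : ι → Set (List α)}
    (hS : ∀ i j, ∀ s ∈ S i, ∀ s' ∈ S j, s <+: s' → i = j) {i : ι} {t : List α} (ht : t ∈ S i)
    (g : List α → ℝ) : branchSum (⋃ i, S i) t g = branchSum (S i) t g := by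
  refine branchSum_congr (fun s hs => ⟨fun h => ?_, fun h => Set.mem_iUnion.2 ⟨i, h⟩⟩)
    fun _ _ _ => rfl
  obtain ⟨j, hj⟩ := Set.mem_iUnion.1 h
  obtain rfl := hS j i s hj t ht hs
  exact hj

theorem branchSum_biUnion {ι : Type*} (I : Finset ι) {S : ι → Set (List α)}
    (hS : ∀ i j, ∀ s ∈ S i, s ∈ S j → i = j) (t : List α) (g : List α → ℝ) :
    branchSum (⋃ i ∈ I, S i) t g = ∑ i ∈ I, branchSum (S i) t g := by
  classical
  induction I using Finset.induction_on with
  | empty => simp [branchSum_empty]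
  | insert a I ha ih =>
    rw [Finset.sum_insert ha, Finset.set_biUnion_insert, branchSum_union, ih]
    rw [Set.disjoint_left]
    intro s hs hs'
    simp only [Set.mem_iUnion] at hs'
    obtain ⟨j, hj, hs'⟩ := hs'
    exact ha (hS a j s hs hs' ▸ hj)

theorem branchSum_append_of_mem_MAX {S : Set (List α)} {t u : List α} (ht : t ∈ MAX S)
    (g : List α → ℝ) : branchSum S (t ++ u) g = branchSum S t g := by
  classical
  unfold branchSum
  refine Finset.sum_congr ?_ fun _ _ => rfl
  ext s
  simp only [Finset.mem_filter, List.mem_toFinset, List.mem_inits]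
  exact ⟨fun h => ⟨prefix_of_mem_MAX ht h.2 h.1, h.2⟩,
    fun h => ⟨h.1.trans (List.prefix_append _ _), h.2⟩⟩

end Lists

/-! ### Prunings between trees with prescribed sets of branches -/

section Prunings

variable {L D : Type*} [Preorder D]

/-- The second entry of the last term of `s` is at most that of the last term of `t`. -/
def LastLE (s t : List (L × D)) : Prop :=
  ∃ s₀ p t₀ q, s = s₀ ++ [p] ∧ t = t₀ ++ [q] ∧ p.2 ≤ q.2

theorem LastLE.refl {s : List (L × D)} (h : s ≠ []) : LastLE s s :=
  ⟨_, _, _, _, (List.dropLast_append_getLast h).symm, (List.dropLast_append_getLast h).symm,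
    le_rfl⟩

theorem LastLE.trans {s t r : List (L × D)} (h : LastLE s t) (h' : LastLE t r) : LastLE s r := by
  obtain ⟨s₀, p, t₀, q, hs, ht, hpq⟩ := h
  obtain ⟨t₁, p', r₀, q', ht', hr, hpq'⟩ := h'
  refine ⟨s₀, p, r₀, q', hs, hr, hpq.trans ?_⟩
  rw [ht] at ht'
  obtain ⟨-, e⟩ := List.append_inj' ht' rfl
  rw [List.singleton_inj.1 e]
  exact hpq'

theorem LastLE.append {s t : List (L × D)} (h : LastLE s t) (x y : List (L × D)) :
    LastLE (x ++ s) (y ++ t) := by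
  obtain ⟨s₀, p, t₀, q, rfl, rfl, hpq⟩ := h
  exact ⟨x ++ s₀, p, y ++ t₀, q, by simp, by simp, hpq⟩

/-- `(θ, e)` is an extended pruning from the tree `S₁` with set of branches `M₁` to the tree `S₂`
with set of branches `M₂`. -/
structure IsPruning (S₁ M₁ S₂ M₂ : Set (List (L × D))) (θ e : List (L × D) → List (L × D)) :
    Prop where
  mapsTo : Set.MapsTo θ S₁ S₂
  monotone : ∀ s ∈ S₁, ∀ s' ∈ S₁, Precedes s s' → Precedes (θ s) (θ s')
  lastLE : ∀ s ∈ S₁, LastLE s (θ s)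
  mapsTo_max : Set.MapsTo e M₁ M₂
  prefix_max : ∀ s ∈ S₁, ∀ t ∈ M₁, s <+: t → θ s <+: e t

variable {S₁ M₁ S₂ M₂ S₃ M₃ : Set (List (L × D))} {θ e θ' e' : List (L × D) → List (L × D)}

theorem IsPruning.comp (h' : IsPruning S₂ M₂ S₃ M₃ θ' e') (h : IsPruning S₁ M₁ S₂ M₂ θ e) :
    IsPruning S₁ M₁ S₃ M₃ (θ' ∘ θ) (e' ∘ e) where
  mapsTo := h'.mapsTo.comp h.mapsTo
  monotone s hs s' hs' hp :=
    h'.monotone _ (h.mapsTo hs) _ (h.mapsTo hs') (h.monotone s hs s' hs' hp)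
  lastLE s hs := (h.lastLE s hs).trans (h'.lastLE _ (h.mapsTo hs))
  mapsTo_max := h'.mapsTo_max.comp h.mapsTo_max
  prefix_max s hs t ht hp :=
    h'.prefix_max _ (h.mapsTo hs) _ (h.mapsTo_max ht) (h.prefix_max s hs t ht hp)

theorem IsPruning.append_left (h : IsPruning S₁ M₁ S₂ M₂ θ e) {S M : Set (List (L × D))}
    {t : List (L × D)} (ht : t ∈ M) :
    IsPruning S₁ M₁ (graft S M S₂) (Set.image2 (· ++ ·) M M₂) (fun s => t ++ θ s)
      (fun s => t ++ e s) where
  mapsTo s hs := Or.inr ⟨t, ht, θ s, h.mapsTo hs, rfl⟩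
  monotone s hs s' hs' hp := (h.monotone s hs s' hs' hp).append_left t
  lastLE s hs := (h.lastLE s hs).append [] t
  mapsTo_max s hs := ⟨t, ht, e s, h.mapsTo_max hs, rfl⟩
  prefix_max s hs w hw hp := (List.prefix_append_right_inj t).2 (h.prefix_max s hs w hw hp)

/-- The base pruning decides which attached copy is entered: what lies above `t` is sent above `e₀
t`, by the pruning that belongs to `e₀ t`. The upper prunings may thus vary with the target branch.
-/
theorem exists_isPruning_graft {S T S' M' T' N N' : Set (List (L × D))}
    {θ₀ e₀ : List (L × D) → List (L × D)}
    {θ e : List (L × D) → List (L × D) → List (L × D)}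
    (hT : [] ∉ T) (h₀ : IsPruning S (MAX S) S' M' θ₀ e₀)
    (h : ∀ t ∈ M', IsPruning T N T' N' (θ t) (e t)) :
    ∃ Θ E, IsPruning (graft S (MAX S) T) (Set.image2 (· ++ ·) (MAX S) N) (graft S' M' T')
        (Set.image2 (· ++ ·) M' N') Θ E ∧
      (∀ s ∈ S, Θ s = θ₀ s) ∧
      (∀ t ∈ MAX S, ∀ u ∈ T, Θ (t ++ u) = e₀ t ++ θ (e₀ t) u) ∧
      ∀ t ∈ MAX S, ∀ u ∈ N, E (t ++ u) = e₀ t ++ e (e₀ t) u := by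
  classical
  have hne : ∀ u ∈ T, u ≠ [] := fun u hu h => hT (h ▸ hu)
  -- Maximal members form an antichain, so the decomposition `t ++ u` is unique; the default `([],
  -- [])` is never used.
  have split : ∀ w, ∃ p : List (L × D) × List (L × D),
      (∃ t ∈ MAX S, ∃ u, w = t ++ u) → p.1 ∈ MAX S ∧ w = p.1 ++ p.2 := by
    intro w
    by_cases hw : ∃ t ∈ MAX S, ∃ u, w = t ++ u
    · obtain ⟨t, ht, u, rfl⟩ := hw
      exact ⟨(t, u), fun _ => ⟨ht, rfl⟩⟩
    · exact ⟨([], []), fun h => absurd h hw⟩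
  choose π hπ using split
  have hπe : ∀ t ∈ MAX S, ∀ u, π (t ++ u) = (t, u) := by
    intro t ht u
    obtain ⟨h1, h2⟩ := hπ (t ++ u) ⟨t, ht, u, rfl⟩
    obtain ⟨e1, -⟩ := mem_MAX_append_inj (u := u) ht h1 (by rw [← h2])
    rw [← e1] at h2
    exact Prod.ext e1.symm (List.append_cancel_left h2).symm
  -- Members of `MAX S` also decompose, with empty second part, so `w ∈ S` is tested first. The map
  -- on branches has no such test, because `N` may contain `[]`.
  refine ⟨fun w => if w ∈ S then θ₀ w else e₀ (π w).1 ++ θ (e₀ (π w).1) (π w).2,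
    fun w => e₀ (π w).1 ++ e (e₀ (π w).1) (π w).2, ?_⟩
  have hΘ : ∀ s ∈ S, (if s ∈ S then θ₀ s else e₀ (π s).1 ++ θ (e₀ (π s).1) (π s).2) = θ₀ s :=
    fun s hs => if_pos hs
  have hΘ' : ∀ t ∈ MAX S, ∀ u ∈ T, (if t ++ u ∈ S then θ₀ (t ++ u) else
      e₀ (π (t ++ u)).1 ++ θ (e₀ (π (t ++ u)).1) (π (t ++ u)).2) = e₀ t ++ θ (e₀ t) u := by
    intro t ht u hu
    rw [if_neg (append_notMem_of_mem_MAX ht (hne u hu)), hπe t ht u]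
  have hE : ∀ t ∈ MAX S, ∀ u ∈ N,
      e₀ (π (t ++ u)).1 ++ e (e₀ (π (t ++ u)).1) (π (t ++ u)).2 = e₀ t ++ e (e₀ t) u := by
    intro t ht u _
    rw [hπe t ht u]
  refine ⟨⟨?_, ?_, ?_, ?_, ?_⟩, hΘ, hΘ', hE⟩
  · rintro _ (hs | ⟨t, ht, u, hu, rfl⟩)
    · simp only [hΘ _ hs]
      exact Or.inl (h₀.mapsTo hs)
    · simp only [hΘ' t ht u hu]
      exact Or.inr ⟨_, h₀.mapsTo_max ht, _, (h _ (h₀.mapsTo_max ht)).mapsTo hu, rfl⟩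
  · rintro s (hs | ⟨t, ht, u, hu, rfl⟩) s' (hs' | ⟨t', ht', u', hu', rfl⟩) hp
    · simp only [hΘ _ hs, hΘ _ hs']
      exact h₀.monotone s hs s' hs' hp
    · simp only [hΘ _ hs, hΘ' t' ht' u' hu']
      refine precedes_append_of_prefix
        (h₀.prefix_max s hs t' ht' (prefix_of_mem_MAX ht' hs hp.1)) ?_
      -- `LastLE` makes the image of `u'` nonempty, which gives strict precedence.
      obtain ⟨_, _, _, _, -, hq, -⟩ := (h _ (h₀.mapsTo_max ht')).lastLE u' hu'
      simp [hq]
    · exact absurd ((precedes_append_of_prefix (List.prefix_refl t) (hne u hu)).trans_prefix hp.1)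
        (ht.2 s' hs')
    · simp only [hΘ' t ht u hu, hΘ' t' ht' u' hu']
      obtain ⟨rfl, -⟩ := mem_MAX_append_inj ht ht' hp.1
      exact ((h _ (h₀.mapsTo_max ht)).monotone u hu u' hu' hp.of_append_left).append_left _
  · rintro _ (hs | ⟨t, ht, u, hu, rfl⟩)
    · simp only [hΘ _ hs]
      exact h₀.lastLE _ hs
    · simp only [hΘ' t ht u hu]
      exact ((h _ (h₀.mapsTo_max ht)).lastLE u hu).append _ _
  · rintro _ ⟨t, ht, u, hu, rfl⟩
    simp only [hE t ht u hu]
    exact ⟨_, h₀.mapsTo_max ht, _, (h _ (h₀.mapsTo_max ht)).mapsTo_max hu, rfl⟩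
  · rintro s (hs | ⟨t, ht, u, hu, rfl⟩) _ ⟨t', ht', u', hu', rfl⟩ hp
    · simp only [hΘ _ hs, hE t' ht' u' hu']
      exact (h₀.prefix_max s hs t' ht' (prefix_of_mem_MAX ht' hs hp)).trans
        (List.prefix_append _ _)
    · simp only [hΘ' t ht u hu, hE t' ht' u' hu']
      obtain ⟨rfl, hp'⟩ := mem_MAX_append_inj ht ht' hp
      exact (List.prefix_append_right_inj _).2
        ((h _ (h₀.mapsTo_max ht)).prefix_max u hu u' hu' hp')

/-- Different pieces are incomparable, so no compatibility between the prunings is needed, even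
though all of them have the same target. -/
theorem exists_isPruning_iUnion {ι : Type*} {S M : ι → Set (List (L × D))}
    {T N : Set (List (L × D))} {θ e : ι → List (L × D) → List (L × D)}
    (hM : ∀ i, M i ⊆ S i) (hS : ∀ i j, ∀ s ∈ S i, ∀ s' ∈ S j, s <+: s' → i = j)
    (h : ∀ i, IsPruning (S i) (M i) T N (θ i) (e i)) :
    ∃ Θ E, IsPruning (⋃ i, S i) (⋃ i, M i) T N Θ E ∧ (∀ i, ∀ s ∈ S i, Θ s = θ i s) ∧
      ∀ i, ∀ t ∈ M i, E t = e i t := by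
  classical
  have key : ∀ φ : ι → List (L × D) → List (L × D), ∃ Φ : List (L × D) → List (L × D),
      ∀ i, ∀ s ∈ S i, Φ s = φ i s := by
    intro φ
    refine ⟨fun s => if hs : ∃ i, s ∈ S i then φ hs.choose s else [], fun i s hs => ?_⟩
    have hs' : ∃ i, s ∈ S i := ⟨i, hs⟩
    have e : hs'.choose = i := hS _ _ s hs'.choose_spec s hs (List.prefix_refl s)
    simp only [dif_pos hs', e]
  obtain ⟨Θ, hΘ⟩ := key θ
  obtain ⟨E, hE⟩ := key e
  refine ⟨Θ, E, ⟨?_, ?_, ?_, ?_, ?_⟩, hΘ, fun i t ht => hE i t (hM i ht)⟩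
  · intro s hs
    obtain ⟨i, hi⟩ := Set.mem_iUnion.1 hs
    rw [hΘ i s hi]
    exact (h i).mapsTo hi
  · intro s hs s' hs' hp
    obtain ⟨i, hi⟩ := Set.mem_iUnion.1 hs
    obtain ⟨j, hj⟩ := Set.mem_iUnion.1 hs'
    obtain rfl := hS i j s hi s' hj hp.1
    rw [hΘ i s hi, hΘ i s' hj]
    exact (h i).monotone s hi s' hj hp
  · intro s hs
    obtain ⟨i, hi⟩ := Set.mem_iUnion.1 hs
    rw [hΘ i s hi]
    exact (h i).lastLE s hi
  · intro s hs
    obtain ⟨i, hi⟩ := Set.mem_iUnion.1 hs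
    rw [hE i s (hM i hi)]
    exact (h i).mapsTo_max hi
  · intro s hs t ht hp
    obtain ⟨i, hi⟩ := Set.mem_iUnion.1 hs
    obtain ⟨j, hj⟩ := Set.mem_iUnion.1 ht
    obtain rfl := hS i j s hi t (hM j hj) hp
    rw [hΘ i s hi, hE i t (hM i hj)]
    exact (h i).prefix_max s hi t hj hp

end Prunings

/-! ### Finite colourings -/

/-- If each colour `k` failed above some `g k`, a common upper bound of the finitely many `g k`
would have no colour left. -/
theorem exists_cofinal_color {ι : Type*} [Preorder ι] [IsDirectedOrder ι] [Nonempty ι]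
    {κ : Type*} [Finite κ] (c : ι → κ) : ∃ k, ∀ i, ∃ j, i ≤ j ∧ c j = k := by
  by_contra! h
  choose g hg using h
  obtain ⟨j, hj⟩ := (Set.finite_range g).bddAbove
  exact hg (c j) j (hj ⟨_, rfl⟩) rfl

/-- The colour of `x` is `⌊x / ε⌋`, which takes finitely many values on `[-1, 1]`; `none` serves the
other reals. -/
theorem exists_rounding {ε : ℝ} (hε : 0 < ε) :
    ∃ (κ : Type) (_ : Finite κ) (ρ : ℝ → κ), ∀ x ∈ Set.Icc (-1 : ℝ) 1, ∀ y ∈ Set.Icc (-1 : ℝ) 1,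
      ρ x = ρ y → |x - y| ≤ ε := by
  classical
  refine ⟨Option (Set.Icc ⌊(-1 : ℝ) / ε⌋ ⌊(1 : ℝ) / ε⌋), inferInstance, fun x =>
    if h : ⌊x / ε⌋ ∈ Set.Icc ⌊(-1 : ℝ) / ε⌋ ⌊(1 : ℝ) / ε⌋ then some ⟨_, h⟩ else none, ?_⟩
  have key : ∀ x ∈ Set.Icc (-1 : ℝ) 1, ⌊x / ε⌋ ∈ Set.Icc ⌊(-1 : ℝ) / ε⌋ ⌊(1 : ℝ) / ε⌋ :=
    fun x hx => ⟨Int.floor_le_floor (by gcongr; exact hx.1),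
      Int.floor_le_floor (by gcongr; exact hx.2)⟩
  intro x hx y hy h
  simp only [dif_pos (key x hx), dif_pos (key y hy), Option.some.injEq, Subtype.mk.injEq] at h
  have h1 := Int.abs_sub_lt_one_of_floor_eq_floor h
  rw [← sub_div, abs_div, abs_of_pos hε, div_lt_one hε] at h1
  exact h1.le

/-! ### Labelled trees -/

section Labels

variable {L : Type*} {D : Type v}

theorem withLabels_image2_append (S T : Set (List L)) :
    withLabels (Set.image2 (· ++ ·) S T) D =
      Set.image2 (· ++ ·) (withLabels S D) (withLabels T D) := by
  ext w
  constructor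
  · rintro ⟨t, ht, u, hu, h⟩
    obtain ⟨w₁, w₂, rfl, rfl, rfl⟩ := List.map_eq_append_iff.1 h.symm
    exact ⟨w₁, ht, w₂, hu, rfl⟩
  · rintro ⟨t, ht, u, hu, rfl⟩
    exact ⟨_, ht, _, hu, by simp⟩

/-- A proper extension of the ordinals lifts to a labelled one by giving the new terms an arbitrary
label, hence `Nonempty D`. -/
theorem withLabels_MAX [Nonempty D] (S : Set (List L)) :
    withLabels (MAX S) D = MAX (withLabels S D) := by
  ext w
  constructor
  · rintro ⟨hw, h⟩
    refine ⟨hw, fun w' hw' hp => h _ hw' ⟨hp.1.map _, fun e => hp.2 ?_⟩⟩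
    refine hp.1.eq_of_length ?_
    simpa using congrArg List.length e
  · rintro ⟨hw, h⟩
    refine ⟨hw, ?_⟩
    rintro _ hw' ⟨⟨r, rfl⟩, hne⟩
    obtain ⟨U⟩ := ‹Nonempty D›
    refine h (w ++ r.map fun x => (x, U)) ?_ (precedes_append_of_prefix (List.prefix_refl w) ?_)
    · simpa [withLabels, Function.comp_def] using hw'
    · rintro e
      exact hne (by simpa using e)

theorem shiftD_pair_injective (ζ : Ordinal.{u}) :
    Function.Injective fun p : Ordinal.{u} × D => (ζ + p.1, p.2) := by
  rintro ⟨a, U⟩ ⟨b, V⟩ h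
  simpa using h

theorem withLabels_shift (ζ : Ordinal.{u}) (S : Set (List Ordinal.{u})) :
    withLabels (shift ζ '' S) D = shiftD ζ '' withLabels S D := by
  ext w
  constructor
  · rintro ⟨t, ht, h⟩
    induction w generalizing t S with
    | nil =>
      obtain rfl : t = [] := by simpa [shift] using h
      exact ⟨[], ht, rfl⟩
    | cons p w ih =>
      cases t with
      | nil => simp [shift] at h
      | cons x t =>
        simp only [shift, List.map_cons, List.cons.injEq] at h
        obtain ⟨w', hw', rfl⟩ := ih {r | x :: r ∈ S} t ht h.2
        refine ⟨(x, p.2) :: w', hw', ?_⟩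
        simp [shiftD, h.1]
  · rintro ⟨t, ht, rfl⟩
    refine ⟨_, ht, ?_⟩
    simp [shift, shiftD, Function.comp_def]

theorem MAX_shift (ζ : Ordinal.{u}) (S : Set (List Ordinal.{u})) :
    MAX (shift ζ '' S) = shift ζ '' MAX S :=
  MAX_image_map (fun _ _ h => add_left_cancel h) S

theorem MAX_shiftD (ζ : Ordinal.{u}) (S : Set (List (Ordinal.{u} × D))) :
    MAX (shiftD ζ '' S) = shiftD ζ '' MAX S :=
  MAX_image_map (shiftD_pair_injective ζ) S

theorem shiftD_prefix_iff (ζ : Ordinal.{u}) {s t : List (Ordinal.{u} × D)} :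
    shiftD ζ s <+: shiftD ζ t ↔ s <+: t :=
  map_prefix_map_iff (shiftD_pair_injective ζ)

theorem precedes_shiftD_iff (ζ : Ordinal.{u}) {s t : List (Ordinal.{u} × D)} :
    Precedes (shiftD ζ s) (shiftD ζ t) ↔ Precedes s t :=
  precedes_map_iff (shiftD_pair_injective ζ)

theorem branchSum_shiftD (ζ : Ordinal.{u}) (S : Set (List (Ordinal.{u} × D)))
    (t : List (Ordinal.{u} × D)) (g : List (Ordinal.{u} × D) → ℝ) :
    branchSum (shiftD ζ '' S) (shiftD ζ t) g = branchSum S t (fun s => g (shiftD ζ s)) :=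
  branchSum_image (shiftD_injective ζ) (fun _ _ => shiftD_prefix_iff ζ) g

theorem LastLE.shiftD [Preorder D] {s t : List (Ordinal.{u} × D)} (h : LastLE s t)
    (ζ η : Ordinal.{u}) : LastLE (BTree.shiftD ζ s) (BTree.shiftD η t) := by
  obtain ⟨s₀, p, t₀, q, rfl, rfl, hpq⟩ := h
  exact ⟨BTree.shiftD ζ s₀, (ζ + p.1, p.2), BTree.shiftD η t₀, (η + q.1, q.2),
    by simp [BTree.shiftD], by simp [BTree.shiftD], hpq⟩

theorem isPruning_shiftD [Preorder D] (ζ : Ordinal.{u}) {S M : Set (List (Ordinal.{u} × D))}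
    (hS : [] ∉ S) :
    IsPruning S M (shiftD ζ '' S) (shiftD ζ '' M) (shiftD ζ) (shiftD ζ) where
  mapsTo := Set.mapsTo_image _ _
  monotone _ _ _ _ hp := (precedes_shiftD_iff ζ).2 hp
  lastLE s hs := by
    have h : LastLE s s := LastLE.refl fun h => hS (h ▸ hs)
    simpa [shiftD] using h.shiftD 0 ζ
  mapsTo_max := Set.mapsTo_image _ _
  prefix_max _ _ _ _ hp := (shiftD_prefix_iff ζ).2 hp

end Labels

/-! ### The recursive structure of `Ω_ξ` and `Ω_{ξ,n}` -/

section Structure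

variable {D : Type v} {ξ : Ordinal.{u}}

/-- The copy `ω ^ ξ * n + Ω_ξ` of `Ω_ξ`, which is the first level of `Ω_{ξ,n+1}`. -/
def block (ξ : Ordinal.{u}) (n : ℕ) (D : Type v) : Set (List (Ordinal.{u} × D)) :=
  shiftD (ω ^ ξ * (n : Ordinal.{u})) '' Omega ξ D

/-- The maximal members of `Ω_{ξ,n}` if `n ≥ 1`, and the empty sequence alone if `n = 0`. -/
def branches (ξ : Ordinal.{u}) : ℕ → (D : Type v) → Set (List (Ordinal.{u} × D))
  | 0, _ => {[]}
  | n + 1, D => Set.image2 (· ++ ·) (MAX (block ξ n D)) (branches ξ n D)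

theorem nil_notMem_Omega : [] ∉ Omega ξ D := fun h => (Gamma_prop ξ _ h).1 rfl

theorem nil_notMem_OmegaN {n : ℕ} : [] ∉ OmegaN ξ n D := by
  intro h
  obtain ⟨⟨x, l, h1, -⟩, -⟩ := stack_prop (Gamma_prop ξ) n _ h
  simp at h1

theorem MAX_block (n : ℕ) :
    MAX (block ξ n D) = shiftD (ω ^ ξ * (n : Ordinal.{u})) '' MAX (Omega ξ D) :=
  MAX_shiftD _ _

theorem GammaN_succ (n : ℕ) :
    GammaN ξ (n + 1) = graft (shift (ω ^ ξ * (n : Ordinal.{u})) '' Gamma ξ)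
      (MAX (shift (ω ^ ξ * (n : Ordinal.{u})) '' Gamma ξ)) (GammaN ξ n) := by
  ext w
  refine or_congr Iff.rfl ?_
  constructor
  · rintro ⟨t, ht, r, hr, rfl⟩
    exact ⟨t, ht, r, hr, rfl⟩
  · rintro ⟨t, ht, r, hr, rfl⟩
    exact ⟨t, ht, r, hr, rfl⟩

theorem OmegaN_zero : OmegaN ξ 0 D = ∅ := rfl

theorem OmegaN_succ [Nonempty D] (n : ℕ) :
    OmegaN ξ (n + 1) D = graft (block ξ n D) (MAX (block ξ n D)) (OmegaN ξ n D) := by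
  rw [OmegaN, GammaN_succ, block, Omega, ← withLabels_shift, ← withLabels_MAX, graft, graft,
    OmegaN, ← withLabels_image2_append]
  rfl

theorem OmegaN_one [Nonempty D] : OmegaN ξ 1 D = block ξ 0 D := by
  rw [OmegaN_succ, OmegaN_zero, graft, Set.image2_empty_right, Set.union_empty]

theorem block_zero : block ξ 0 D = Omega ξ D := by
  have h : (shiftD 0 : List (Ordinal.{u} × D) → List (Ordinal.{u} × D)) = id := by
    funext t
    simp [shiftD]
  simp [block, h]

theorem Omega_zero : Omega (0 : Ordinal.{u}) D = Set.range fun U => [((0 : Ordinal.{u}), U)] := by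
  ext w
  simp only [Omega, withLabels, Gamma_zero, Set.mem_ofPred_eq, Set.mem_singleton_iff,
    Set.mem_range]
  constructor
  · intro h
    obtain ⟨⟨x, U⟩, rfl⟩ : ∃ p, w = [p] := by
      simpa [List.length_eq_one_iff] using congrArg List.length h
    refine ⟨U, ?_⟩
    simp at h
    simp [h]
  · rintro ⟨U, rfl⟩
    simp

theorem MAX_Omega_zero : MAX (Omega (0 : Ordinal.{u}) D) = Omega 0 D := by
  rw [Omega_zero]
  refine Set.Subset.antisymm (fun _ h => h.1) ?_
  rintro _ ⟨U, rfl⟩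
  refine ⟨⟨U, rfl⟩, ?_⟩
  rintro _ ⟨V, rfl⟩ hp
  exact hp.2 (hp.1.eq_of_length rfl)

theorem Omega_add_one : Omega (ξ + 1) D = ⋃ n : ℕ, OmegaN ξ (n + 1) D := by
  ext w
  simp only [Omega, withLabels, Gamma_add_one, OmegaN, Set.mem_iUnion, Set.mem_ofPred_eq]
  constructor
  · rintro ⟨n, hn, h⟩
    obtain ⟨n, rfl⟩ := Nat.exists_eq_add_of_le' hn
    exact ⟨n, h⟩
  · rintro ⟨n, h⟩
    exact ⟨n + 1, Nat.le_add_left 1 n, h⟩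

/-- The first ordinal `x` determines `n`, through `x / ω ^ ξ + 1 = n`. -/
theorem eq_of_prefix_of_mem_OmegaN {n n' : ℕ} {s s' : List (Ordinal.{u} × D)}
    (hs : s ∈ OmegaN ξ n D) (hs' : s' ∈ OmegaN ξ n' D) (h : s <+: s') : n = n' := by
  obtain ⟨⟨x, l, h1, h2⟩, -⟩ := stack_prop (Gamma_prop ξ) n _ hs
  obtain ⟨⟨x', l', h1', h2'⟩, -⟩ := stack_prop (Gamma_prop ξ) n' _ hs'
  obtain ⟨r, hr⟩ := h.map Prod.fst
  rw [h1, h1'] at hr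
  simp only [List.cons_append, List.cons.injEq] at hr
  rw [← hr.1, h2] at h2'
  exact_mod_cast h2'

theorem Omega_add_one_disjoint (i j : ℕ) (s : List (Ordinal.{u} × D))
    (hs : s ∈ OmegaN ξ (i + 1) D) (s' : List (Ordinal.{u} × D)) (hs' : s' ∈ OmegaN ξ (j + 1) D)
    (h : s <+: s') : i = j :=
  Nat.succ_injective (eq_of_prefix_of_mem_OmegaN hs hs' h)

theorem Omega_limit (hξ : Order.IsSuccLimit ξ) :
    Omega ξ D = ⋃ ζ : Set.Iio ξ, shiftD (ω ^ ζ.1) '' Omega (ζ.1 + 1) D := by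
  simp only [Omega, ← withLabels_shift]
  ext w
  simp only [withLabels, Gamma_limit hξ, Set.mem_iUnion, Set.mem_ofPred_eq]
  constructor
  · rintro ⟨ζ, hζ, r, hr, h⟩
    exact ⟨⟨ζ, hζ⟩, r, hr, h.symm⟩
  · rintro ⟨⟨ζ, hζ⟩, r, hr, h⟩
    exact ⟨ζ, hζ, r, hr, h.symm⟩

/-- All ordinals in the piece of index `ζ` lie in `[ω ^ ζ, ω ^ (ζ + 1))`, so any single term
identifies the piece. -/
theorem Omega_limit_disjoint (i j : Set.Iio ξ) (s : List (Ordinal.{u} × D))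
    (hs : s ∈ shiftD (ω ^ i.1) '' Omega (i.1 + 1) D) (s' : List (Ordinal.{u} × D))
    (hs' : s' ∈ shiftD (ω ^ j.1) '' Omega (j.1 + 1) D) (h : s <+: s') : i = j := by
  have bound : ∀ {ζ : Ordinal.{u}} {s : List (Ordinal.{u} × D)},
      s ∈ shiftD (ω ^ ζ) '' Omega (ζ + 1) D → ∀ p ∈ s, ω ^ ζ ≤ p.1 ∧ p.1 < ω ^ (ζ + 1) := by
    rintro ζ _ ⟨r, hr, rfl⟩ p hp
    simp only [shiftD, List.mem_map] at hp
    obtain ⟨q, hq, rfl⟩ := hp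
    refine ⟨le_self_add, Ordinal.isPrincipal_add_omega0_opow (ζ + 1) ?_
      ((Gamma_prop _ _ hr).2 _ (List.mem_map_of_mem hq))⟩
    exact (Ordinal.opow_lt_opow_iff_right Ordinal.one_lt_omega0).2 (lt_add_one ζ)
  have hne : s ≠ [] := by
    rintro rfl
    obtain ⟨r, hr, h⟩ := hs
    obtain rfl : r = [] := by simpa [shiftD] using h
    exact nil_notMem_Omega hr
  obtain ⟨p, hp⟩ := List.exists_mem_of_ne_nil _ hne
  obtain ⟨b1, b2⟩ := bound hs p hp
  obtain ⟨c1, c2⟩ := bound hs' p (h.subset hp)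
  have l1 := (Ordinal.opow_lt_opow_iff_right Ordinal.one_lt_omega0).1 (b1.trans_lt c2)
  have l2 := (Ordinal.opow_lt_opow_iff_right Ordinal.one_lt_omega0).1 (c1.trans_lt b2)
  exact Subtype.ext (le_antisymm (Order.lt_add_one_iff.1 l1) (Order.lt_add_one_iff.1 l2))

theorem MAX_Omega_nonempty [Nonempty D] (ξ : Ordinal.{u}) : (MAX (Omega ξ D)).Nonempty := by
  induction ξ using Ordinal.limitRecOn with
  | zero =>
    rw [MAX_Omega_zero, Omega_zero]
    exact Set.range_nonempty _
  | add_one ξ ih =>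
    rw [Omega_add_one, MAX_iUnion Omega_add_one_disjoint]
    refine Set.nonempty_iUnion.2 ⟨0, ?_⟩
    rwa [zero_add, OmegaN_one, block_zero]
  | limit ξ hξ ih =>
    rw [Omega_limit hξ, MAX_iUnion Omega_limit_disjoint]
    refine Set.nonempty_iUnion.2 ⟨⟨0, hξ.pos⟩, ?_⟩
    rw [MAX_shiftD]
    exact (ih _ (hξ.succ_lt hξ.pos)).image _

theorem MAX_block_nonempty [Nonempty D] (n : ℕ) : (MAX (block ξ n D)).Nonempty := by
  rw [MAX_block]
  exact (MAX_Omega_nonempty ξ).image _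

theorem OmegaN_nonempty [Nonempty D] (n : ℕ) : (OmegaN ξ (n + 1) D).Nonempty := by
  rw [OmegaN_succ]
  obtain ⟨t, ht⟩ := MAX_block_nonempty (ξ := ξ) (D := D) n
  exact ⟨t, Or.inl ht.1⟩

theorem branches_nonempty [Nonempty D] (n : ℕ) : (branches ξ n D).Nonempty := by
  induction n with
  | zero => exact ⟨[], rfl⟩
  | succ n ih => exact (MAX_block_nonempty n).image2 ih

theorem MAX_OmegaN [Nonempty D] (n : ℕ) : MAX (OmegaN ξ (n + 1) D) = branches ξ (n + 1) D := by
  induction n with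
  | zero => rw [OmegaN_one, branches, branches, Set.image2_singleton_right]; simp
  | succ n ih =>
    rw [OmegaN_succ, MAX_graft (OmegaN_nonempty n) nil_notMem_OmegaN, ih]
    rfl

theorem branches_eq_MAX [Nonempty D] {n : ℕ} (hn : 1 ≤ n) : branches ξ n D = MAX (OmegaN ξ n D) := by
  obtain ⟨n, rfl⟩ := Nat.exists_eq_add_of_le' hn
  exact (MAX_OmegaN n).symm

theorem OmegaN_eq_empty [IsEmpty D] {n : ℕ} : OmegaN ξ n D = ∅ := by
  refine Set.eq_empty_of_forall_notMem fun t ht => ?_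
  rcases t with _ | ⟨p, t⟩
  · exact nil_notMem_OmegaN ht
  · exact isEmptyElim p.2

/-! ### Levels and units -/

theorem hasBlocks_one {n : ℕ} {t : List Ordinal.{u}} :
    HasBlocks ξ (n + 1) 1 t ↔ t ∈ shift (ω ^ ξ * (n : Ordinal.{u})) '' Gamma ξ := by
  constructor
  · rintro ⟨b, hb, -, rfl⟩
    exact ⟨b 0, hb 0 one_pos, by simp⟩
  · rintro ⟨r, hr, rfl⟩
    exact ⟨fun _ => r, fun _ _ => hr, fun i hi => by omega, by simp⟩

theorem hasBlocks_succ {n m : ℕ} {t : List Ordinal.{u}} :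
    HasBlocks ξ (n + 1) (m + 2) t ↔
      t ∈ Set.image2 (· ++ ·) (MAX (shift (ω ^ ξ * (n : Ordinal.{u})) '' Gamma ξ))
        {r | HasBlocks ξ n (m + 1) r} := by
  rw [MAX_shift]
  constructor
  · rintro ⟨b, hb, hb', rfl⟩
    refine ⟨_, ⟨b 0, hb' 0 (by omega), rfl⟩, _, ⟨fun i => b (i + 1), fun i hi => hb _ (by omega),
      fun i hi => hb' _ (by omega), rfl⟩, ?_⟩
    rw [List.range_succ_eq_map (n := m + 1), List.flatMap_cons, List.flatMap_map]
    simp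
  · rintro ⟨_, ⟨r, hr, rfl⟩, _, ⟨b, hb, hb', rfl⟩, rfl⟩
    -- The blocks `b`, preceded by the new first block `r`.
    refine ⟨fun i => Nat.casesOn i r b, ?_, ?_, ?_⟩
    · rintro (_ | i) hi
      · exact hr.1
      · exact hb i (by omega)
    · rintro (_ | i) hi
      · exact hr
      · exact hb' i (by omega)
    · rw [List.range_succ_eq_map (n := m + 1), List.flatMap_cons, List.flatMap_map]
      simp

theorem HasBlocks.mem_GammaN {n m : ℕ} {t : List Ordinal.{u}} (hm : m + 1 ≤ n)
    (h : HasBlocks ξ n (m + 1) t) : t ∈ GammaN ξ n := by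
  induction n generalizing m t with
  | zero => omega
  | succ n ih =>
    rw [GammaN_succ]
    cases m with
    | zero => exact Or.inl (hasBlocks_one.1 h)
    | succ m =>
      obtain ⟨t, ht, r, hr, rfl⟩ := hasBlocks_succ.1 h
      exact Or.inr ⟨t, ht, r, ih (by omega) hr, rfl⟩

theorem Level_eq_withLabels {n m : ℕ} (hm : m + 1 ≤ n) :
    Level ξ n (m + 1) D = withLabels {t | HasBlocks ξ n (m + 1) t} D := by
  ext t
  exact ⟨fun h => h.2.2.2, fun h => ⟨h.mem_GammaN hm, by omega, hm, h⟩⟩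

theorem Level_eq_empty {n m : ℕ} (hm : n < m) : Level ξ n m D = ∅ :=
  Set.eq_empty_of_forall_notMem fun _ h => absurd h.2.2.1 (by omega)

theorem Level_zero_right {n : ℕ} : Level ξ n 0 D = ∅ :=
  Set.eq_empty_of_forall_notMem fun _ h => absurd h.2.1 (by omega)

theorem Level_one {n : ℕ} : Level ξ (n + 1) 1 D = block ξ n D := by
  rw [Level_eq_withLabels (by omega), block, Omega, ← withLabels_shift]
  congr 1
  ext t
  exact hasBlocks_one

theorem Level_succ [Nonempty D] {n m : ℕ} :
    Level ξ (n + 1) (m + 2) D =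
      Set.image2 (· ++ ·) (MAX (block ξ n D)) (Level ξ n (m + 1) D) := by
  rcases le_or_gt (m + 1) n with hm | hm
  · rw [Level_eq_withLabels (by omega), Level_eq_withLabels hm, block, Omega, ← withLabels_shift,
      ← withLabels_MAX, ← withLabels_image2_append]
    congr 1
    ext t
    exact hasBlocks_succ
  · rw [Level_eq_empty hm, Level_eq_empty (by omega), Set.image2_empty_right]

theorem Level_subset {n m : ℕ} : Level ξ n m D ⊆ OmegaN ξ n D := fun _ h => h.1

theorem nil_notMem_Level {n m : ℕ} : [] ∉ Level ξ n m D := fun h => nil_notMem_OmegaN h.1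

theorem Level_disjoint [Nonempty D] {n i j : ℕ} {s : List (Ordinal.{u} × D)}
    (hi : s ∈ Level ξ n i D) (hj : s ∈ Level ξ n j D) : i = j := by
  induction n generalizing i j s with
  | zero => exact absurd hi.2.2.1 (by have := hi.2.1; omega)
  | succ n ih =>
    have h01 : ∀ {m : ℕ} {s : List (Ordinal.{u} × D)}, s ∈ Level ξ (n + 1) 1 D →
        s ∉ Level ξ (n + 1) (m + 2) D := by
      intro m s h h'
      rw [Level_one] at h
      rw [Level_succ] at h'
      obtain ⟨t, ht, u, hu, rfl⟩ := h'
      exact append_notMem_of_mem_MAX ht (fun e => nil_notMem_Level (e ▸ hu)) h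
    rcases i with _ | _ | i
    · exact absurd hi.2.1 (by omega)
    · rcases j with _ | _ | j
      · exact absurd hj.2.1 (by omega)
      · rfl
      · exact absurd hj (h01 hi)
    · rcases j with _ | _ | j
      · exact absurd hj.2.1 (by omega)
      · exact absurd hi (h01 hj)
      · rw [Level_succ] at hi hj
        obtain ⟨t, ht, u, hu, rfl⟩ := hi
        obtain ⟨t', ht', u', hu', e⟩ := hj
        obtain ⟨rfl, -⟩ := mem_MAX_append_inj (u := u') (u' := u) ht' ht (by simp [e])
        rw [List.append_cancel_left e] at hu'
        have := ih hu hu'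
        omega

theorem OmegaN_eq_iUnion_Level [Nonempty D] (n : ℕ) :
    OmegaN ξ n D = ⋃ i ∈ Finset.range n, Level ξ n (i + 1) D := by
  refine Set.Subset.antisymm ?_ (Set.iUnion₂_subset fun _ _ => Level_subset)
  induction n with
  | zero => exact fun _ h => absurd h (by simp [OmegaN_zero])
  | succ n ih =>
    rw [OmegaN_succ]
    simp only [Set.subset_def, Set.mem_iUnion, Finset.mem_range] at ih ⊢
    rintro _ (hs | ⟨t, ht, u, hu, rfl⟩)
    · exact ⟨0, by omega, by rwa [Level_one]⟩
    · obtain ⟨i, hi, h⟩ := ih u hu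
      refine ⟨i + 1, by omega, ?_⟩
      rw [Level_succ]
      exact ⟨t, ht, u, h, rfl⟩

theorem branchSum_OmegaN [Nonempty D] (n : ℕ) (t : List (Ordinal.{u} × D))
    (g : List (Ordinal.{u} × D) → ℝ) :
    branchSum (OmegaN ξ n D) t g = ∑ i ∈ Finset.range n, branchSum (Level ξ n (i + 1) D) t g := by
  rw [OmegaN_eq_iUnion_Level, branchSum_biUnion]
  intro i j s hi hj
  exact Nat.succ_injective (Level_disjoint hi hj)

theorem isUnitBase_succ [Nonempty D] {n k : ℕ} {s : List (Ordinal.{u} × D)} :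
    IsUnitBase ξ (n + 1) k s ↔
      s = [] ∧ k = n ∨ ∃ t ∈ MAX (block ξ n D), ∃ s', s = t ++ s' ∧ IsUnitBase ξ n k s' := by
  refine or_congr (and_congr Iff.rfl (by omega)) ?_
  constructor
  · rintro ⟨m, h1, h2, h3⟩
    rcases m with _ | _ | m
    · omega
    · rw [zero_add, Level_one] at h3
      exact ⟨s, h3, [], by simp, Or.inl ⟨rfl, by omega⟩⟩
    · rw [Level_succ, MAX_image2_append] at h3
      obtain ⟨t, ht, u, hu, rfl⟩ := h3
      exact ⟨t, ht, u, rfl, Or.inr ⟨m + 1, by omega, by omega, hu⟩⟩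
  · rintro ⟨t, ht, s', rfl, ⟨rfl, h⟩ | ⟨m, h1, h2, h3⟩⟩
    · refine ⟨1, le_rfl, by omega, ?_⟩
      rwa [Level_one, List.append_nil]
    · obtain ⟨m, rfl⟩ := Nat.exists_eq_add_of_le' h1
      refine ⟨m + 2, by omega, by omega, ?_⟩
      rw [Level_succ, MAX_image2_append]
      exact ⟨t, ht, s', h3, rfl⟩

/-- This recursion follows the grafting in `OmegaN_succ`, so unit preservation can be checked by
induction on `n`. -/
theorem isTreeUnit_succ [Nonempty D] {n : ℕ} {U : Set (List (Ordinal.{u} × D))} :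
    IsTreeUnit ξ (n + 1) U ↔
      U = block ξ n D ∨ ∃ t ∈ MAX (block ξ n D), ∃ V, IsTreeUnit ξ n V ∧
        U = (fun w => t ++ w) '' V := by
  constructor
  · rintro ⟨k, s, hs, rfl⟩
    rcases isUnitBase_succ.1 hs with ⟨rfl, rfl⟩ | ⟨t, ht, s', rfl, hs'⟩
    · left
      ext w
      simp [block, eq_comm]
    · refine Or.inr ⟨t, ht, _, ⟨k, s', hs', rfl⟩, ?_⟩
      ext w
      constructor
      · rintro ⟨r, hr, rfl⟩
        exact ⟨_, ⟨r, hr, rfl⟩, by simp⟩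
      · rintro ⟨_, ⟨r, hr, rfl⟩, rfl⟩
        exact ⟨r, hr, by simp⟩
  · rintro (rfl | ⟨t, ht, _, ⟨k, s, hs, rfl⟩, rfl⟩)
    · refine ⟨n, [], isUnitBase_succ.2 (Or.inl ⟨rfl, rfl⟩), ?_⟩
      ext w
      simp [block, eq_comm]
    · refine ⟨k, t ++ s, isUnitBase_succ.2 (Or.inr ⟨t, ht, s, rfl, hs⟩), ?_⟩
      ext w
      constructor
      · rintro ⟨_, ⟨r, hr, rfl⟩, rfl⟩
        exact ⟨r, hr, by simp⟩
      · rintro ⟨r, hr, rfl⟩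
        exact ⟨_, ⟨r, hr, rfl⟩, by simp⟩

theorem not_isTreeUnit_zero {U : Set (List (Ordinal.{u} × D))} : ¬ IsTreeUnit ξ 0 U := by
  rintro ⟨k, s, ⟨-, h⟩ | ⟨m, -, h, -⟩, -⟩ <;> omega

theorem IsTreeUnit.subset_OmegaN [Nonempty D] {n : ℕ} {U : Set (List (Ordinal.{u} × D))}
    (h : IsTreeUnit ξ n U) : U ⊆ OmegaN ξ n D := by
  induction n generalizing U with
  | zero => exact absurd h not_isTreeUnit_zero
  | succ n ih =>
    rw [OmegaN_succ]
    rcases isTreeUnit_succ.1 h with rfl | ⟨t, ht, V, hV, rfl⟩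
    · exact Set.subset_union_left
    · rintro _ ⟨u, hu, rfl⟩
      exact Or.inr ⟨t, ht, u, ih hV hu, rfl⟩

theorem exists_isIota [Nonempty D] {n : ℕ} {s : List (Ordinal.{u} × D)} (hs : s ∈ OmegaN ξ n D) :
    ∃ r, IsIota ξ n s r := by
  induction n generalizing s with
  | zero => exact absurd hs (by simp [OmegaN_zero])
  | succ n ih =>
    rw [OmegaN_succ] at hs
    rcases hs with ⟨r, hr, rfl⟩ | ⟨t, ht, u, hu, rfl⟩
    · exact ⟨r, hr, n, [], isUnitBase_succ.2 (Or.inl ⟨rfl, rfl⟩), rfl⟩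
    · obtain ⟨r, hr, k, s, hs, rfl⟩ := ih hu
      exact ⟨r, hr, k, t ++ s, isUnitBase_succ.2 (Or.inr ⟨t, ht, s, rfl, hs⟩), by simp⟩

theorem iota_mem_Omega [Nonempty D] {n : ℕ} {s : List (Ordinal.{u} × D)}
    (hs : s ∈ OmegaN ξ n D) : iota ξ n s ∈ Omega ξ D := by
  obtain ⟨r, hr, k, s, hb, rfl⟩ := exists_isIota hs
  rwa [iota_eq hb hr]

theorem iota_shiftD [Nonempty D] {n : ℕ} {r : List (Ordinal.{u} × D)} (hr : r ∈ Omega ξ D) :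
    iota ξ (n + 1) (shiftD (ω ^ ξ * (n : Ordinal.{u})) r) = r :=
  iota_eq (s := []) (isUnitBase_succ.2 (Or.inl ⟨rfl, rfl⟩)) hr

theorem iota_append [Nonempty D] {n : ℕ} {t s : List (Ordinal.{u} × D)}
    (ht : t ∈ MAX (block ξ n D)) (hs : s ∈ OmegaN ξ n D) :
    iota ξ (n + 1) (t ++ s) = iota ξ n s := by
  obtain ⟨r, hr, k, s, hb, rfl⟩ := exists_isIota hs
  rw [iota_eq hb hr, ← List.append_assoc,
    iota_eq (isUnitBase_succ.2 (Or.inr ⟨t, ht, s, rfl, hb⟩)) hr]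

/-! ### Weighted sums along branches -/

/-- `∑ ℙ_ξ(s) f(s, t)` over the `s ∈ Ω_ξ` with `s ⪯ t`. -/
noncomputable def avg (ξ : Ordinal.{u}) (f : List (Ordinal.{u} × D) → ℝ)
    (t : List (Ordinal.{u} × D)) : ℝ :=
  branchSum (Omega ξ D) t fun s => P ξ s * f s

/-- `∑ ℙ_ξ(ι_{ξ,n}(s)) f(s, t)` over the `s ∈ Λ_{ξ,n,i}` with `s ⪯ t`. -/
noncomputable def levelAvg (ξ : Ordinal.{u}) (n i : ℕ) (f : List (Ordinal.{u} × D) → ℝ)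
    (t : List (Ordinal.{u} × D)) : ℝ :=
  branchSum (Level ξ n i D) t fun s => P ξ (iota ξ n s) * f s

theorem levelAvg_one [Nonempty D] {n : ℕ} {r u : List (Ordinal.{u} × D)}
    (hr : r ∈ MAX (Omega ξ D)) (f : List (Ordinal.{u} × D) → ℝ) :
    levelAvg ξ (n + 1) 1 f (shiftD (ω ^ ξ * (n : Ordinal.{u})) r ++ u) =
      avg ξ (fun s => f (shiftD (ω ^ ξ * (n : Ordinal.{u})) s)) r := by
  rw [levelAvg, Level_one, branchSum_append_of_mem_MAX, block, branchSum_shiftD]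
  · exact branchSum_congr (fun _ _ => Iff.rfl) fun s hs _ => by rw [iota_shiftD hs]
  · rw [MAX_block]
    exact ⟨r, hr, rfl⟩

theorem levelAvg_succ [Nonempty D] {n i : ℕ} {t u : List (Ordinal.{u} × D)}
    (ht : t ∈ MAX (block ξ n D)) (f : List (Ordinal.{u} × D) → ℝ) :
    levelAvg ξ (n + 1) (i + 2) f (t ++ u) = levelAvg ξ n (i + 1) (fun s => f (t ++ s)) u := by
  rw [levelAvg, Level_succ, branchSum_image2_append ht, levelAvg]
  exact branchSum_congr (fun _ _ => Iff.rfl) fun s hs _ => by rw [iota_append ht hs.1]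

theorem avg_add_one [Nonempty D] {n : ℕ} {t : List (Ordinal.{u} × D)}
    (ht : t ∈ OmegaN ξ (n + 1) D) (f : List (Ordinal.{u} × D) → ℝ) :
    avg (ξ + 1) f t =
      1 / ((n + 1 : ℕ) : ℝ) * ∑ i ∈ Finset.range (n + 1), levelAvg ξ (n + 1) (i + 1) f t := by
  rw [avg, Omega_add_one, branchSum_iUnion Omega_add_one_disjoint ht]
  simp only [levelAvg]
  rw [← branchSum_OmegaN, ← branchSum_mul_left]
  refine branchSum_congr (fun _ _ => Iff.rfl) fun s hs _ => ?_
  rw [P_add_one (Nat.le_add_left 1 n) hs, mul_assoc]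

theorem avg_limit (hξ : Order.IsSuccLimit ξ) {ζ : Ordinal.{u}} (hζ : ζ < ξ)
    {t : List (Ordinal.{u} × D)} (ht : t ∈ Omega (ζ + 1) D) (f : List (Ordinal.{u} × D) → ℝ) :
    avg ξ f (shiftD (ω ^ ζ) t) = avg (ζ + 1) (fun s => f (shiftD (ω ^ ζ) s)) t := by
  rw [avg, Omega_limit hξ, branchSum_iUnion Omega_limit_disjoint (i := ⟨ζ, hζ⟩) ⟨t, ht, rfl⟩,
    branchSum_shiftD, avg]
  exact branchSum_congr (fun _ _ => Iff.rfl) fun s hs _ => by rw [P_limit hξ hζ hs]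

theorem P_nonneg [Nonempty D] (ξ : Ordinal.{u}) :
    ∀ s ∈ Omega ξ D, 0 ≤ P ξ s := by
  induction ξ using Ordinal.limitRecOn with
  | zero => intro s _; rw [P_zero]; exact zero_le_one
  | add_one ξ ih =>
    intro s hs
    rw [Omega_add_one] at hs
    obtain ⟨n, hn⟩ := Set.mem_iUnion.1 hs
    rw [P_add_one (Nat.le_add_left 1 n) hn]
    exact mul_nonneg (by positivity) (ih _ (iota_mem_Omega hn))
  | limit ξ hξ ih =>
    intro s hs
    rw [Omega_limit hξ] at hs
    obtain ⟨⟨ζ, hζ⟩, r, hr, rfl⟩ := Set.mem_iUnion.1 hs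
    rw [P_limit hξ hζ hr]
    exact ih _ (hξ.succ_lt hζ) r hr

/-- A branch meets each level inside a single unit, a copy of Ω_ξ embedded by `φ`. Bounds for level
averages thus reduce to bounds for `avg`. -/
theorem levelAvg_eq_avg [Nonempty D] {n i : ℕ} {t : List (Ordinal.{u} × D)} (hi : i < n)
    (ht : t ∈ branches ξ n D) (f : List (Ordinal.{u} × D) → ℝ) :
    ∃ s ∈ MAX (Omega ξ D), ∃ φ : List (Ordinal.{u} × D) → List (Ordinal.{u} × D),
      (∀ r ∈ Omega ξ D, r <+: s → φ r ∈ Level ξ n (i + 1) D ∧ φ r <+: t) ∧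
      levelAvg ξ n (i + 1) f t = avg ξ (fun r => f (φ r)) s := by
  induction n generalizing i t f with
  | zero => omega
  | succ n ih =>
    obtain ⟨w, hw, u, hu, rfl⟩ := ht
    cases i with
    | zero =>
      rw [MAX_block] at hw
      obtain ⟨r, hr, rfl⟩ := hw
      refine ⟨r, hr, shiftD (ω ^ ξ * (n : Ordinal.{u})), fun s hs hp => ⟨?_, ?_⟩,
        levelAvg_one hr f⟩
      · rw [Level_one]
        exact ⟨s, hs, rfl⟩
      · exact ((shiftD_prefix_iff _).2 hp).trans (List.prefix_append _ _)
    | succ i =>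
      obtain ⟨s, hs, φ, hφ, h⟩ := ih (Nat.lt_of_succ_lt_succ hi) hu (fun s => f (w ++ s))
      refine ⟨s, hs, fun r => w ++ φ r, fun r hr hp => ⟨?_, ?_⟩, ?_⟩
      · rw [Level_succ]
        exact ⟨w, hw, φ r, (hφ r hr hp).1, rfl⟩
      · exact (List.prefix_append_right_inj w).2 (hφ r hr hp).2
      · rw [levelAvg_succ hw, h]

/-- At a successor each of the `n + 1` levels contributes at most 1, and the sum is divided by `n +
1`. The inequality suffices below, because only nonnegative constants are added to `f`. -/
theorem avg_one_le [Nonempty D] (ξ : Ordinal.{u}) :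
    ∀ t ∈ MAX (Omega ξ D), avg ξ (fun _ => 1) t ≤ 1 := by
  induction ξ using Ordinal.limitRecOn with
  | zero =>
    intro t ht
    rw [MAX_Omega_zero] at ht
    have h : branchSum (Omega 0 D) t (fun _ => 1) ≤ 1 := by
      classical
      rw [branchSum, Finset.sum_const, _root_.nsmul_eq_mul, mul_one, ← Nat.cast_one, Nat.cast_le,
        Finset.card_le_one]
      simp only [Finset.mem_filter, List.mem_toFinset, List.mem_inits, and_imp]
      intro a hat ha b hbt hb
      rw [Omega_zero] at ha hb
      obtain ⟨U, rfl⟩ := ha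
      obtain ⟨V, rfl⟩ := hb
      exact (List.prefix_of_prefix_length_le hat hbt le_rfl).eq_of_length rfl
    simpa [avg, P_zero] using h
  | add_one ξ ih =>
    intro t ht
    rw [Omega_add_one, MAX_iUnion Omega_add_one_disjoint] at ht
    obtain ⟨n, hn⟩ := Set.mem_iUnion.1 ht
    rw [avg_add_one hn.1, one_div, inv_mul_le_iff₀ (by positivity), mul_one]
    refine (Finset.sum_le_card_nsmul _ _ 1 fun i hi => ?_).trans (by simp)
    rw [MAX_OmegaN] at hn
    obtain ⟨s, hs, φ, -, h⟩ := levelAvg_eq_avg (Finset.mem_range.1 hi) hn fun _ => 1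
    rw [h]
    exact ih s hs
  | limit ξ hξ ih =>
    intro t ht
    rw [Omega_limit hξ, MAX_iUnion Omega_limit_disjoint] at ht
    obtain ⟨⟨ζ, hζ⟩, h⟩ := Set.mem_iUnion.1 ht
    rw [MAX_shiftD] at h
    obtain ⟨r, hr, rfl⟩ := h
    rw [avg_limit hξ hζ hr.1]
    exact ih _ (hξ.succ_lt hζ) r hr

theorem avg_le_avg_add [Nonempty D] {t : List (Ordinal.{u} × D)} (ht : t ∈ MAX (Omega ξ D))
    {f g : List (Ordinal.{u} × D) → ℝ} {x : ℝ} (hx : 0 ≤ x)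
    (h : ∀ s ∈ Omega ξ D, s <+: t → f s ≤ g s + x) : avg ξ f t ≤ avg ξ g t + x := by
  calc avg ξ f t ≤ branchSum (Omega ξ D) t (fun s => P ξ s * g s + x * (P ξ s * 1)) := by
        refine branchSum_mono fun s hs hp => ?_
        have := mul_le_mul_of_nonneg_left (h s hs hp) (P_nonneg ξ s hs)
        linarith
    _ = avg ξ g t + x * avg ξ (fun _ => 1) t := by
        rw [branchSum_add, branchSum_mul_left]
        rfl
    _ ≤ avg ξ g t + x := by
        have := mul_le_mul_of_nonneg_left (avg_one_le ξ t ht) hx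
        linarith

theorem avg_zero (t : List (Ordinal.{u} × D)) : avg ξ (fun _ => 0) t = 0 := by
  simp [avg, branchSum]

theorem avg_neg (f : List (Ordinal.{u} × D) → ℝ) (t : List (Ordinal.{u} × D)) :
    avg ξ (fun s => -f s) t = -avg ξ f t := by
  simp [avg, branchSum]

theorem avg_mem_Icc [Nonempty D] {t : List (Ordinal.{u} × D)} (ht : t ∈ MAX (Omega ξ D))
    {f : List (Ordinal.{u} × D) → ℝ} (h : ∀ s ∈ Omega ξ D, s <+: t → f s ∈ Set.Icc (-1 : ℝ) 1) :
    avg ξ f t ∈ Set.Icc (-1 : ℝ) 1 := by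
  have h1 := avg_le_avg_add ht zero_le_one (f := f) (g := fun _ => 0) fun s hs hp => by
    simpa using (h s hs hp).2
  have h2 := avg_le_avg_add ht zero_le_one (f := fun s => -f s) (g := fun _ => 0)
    fun s hs hp => by linarith [(h s hs hp).1]
  rw [avg_zero] at h1 h2
  rw [avg_neg] at h2
  exact ⟨by linarith, by linarith⟩

theorem levelAvg_mem_Icc [Nonempty D] {n i : ℕ} {t : List (Ordinal.{u} × D)} (hi : i < n)
    (ht : t ∈ branches ξ n D) {f : List (Ordinal.{u} × D) → ℝ}
    (h : ∀ s ∈ OmegaN ξ n D, s <+: t → f s ∈ Set.Icc (-1 : ℝ) 1) :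
    levelAvg ξ n (i + 1) f t ∈ Set.Icc (-1 : ℝ) 1 := by
  obtain ⟨s, hs, φ, hφ, e⟩ := levelAvg_eq_avg hi ht f
  rw [e]
  exact avg_mem_Icc hs fun r hr hp => h _ (hφ r hr hp).1.1 (hφ r hr hp).2

end Structure

/-! ### Operations on prunings -/

section Operations

variable {L D : Type*} [Preorder D] {S M S' M' S'' M'' : Set (List (L × D))}
  {θ e : List (L × D) → List (L × D)}

theorem IsPruning.mono_right (h : IsPruning S M S' M' θ e) (hS : S' ⊆ S'') (hM : M' ⊆ M'') :
    IsPruning S M S'' M'' θ e :=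
  ⟨fun _ hs => hS (h.mapsTo hs), h.monotone, h.lastLE, fun _ hs => hM (h.mapsTo_max hs),
    h.prefix_max⟩

/-- Shared by the successor and limit steps: `R` fixes the colour of a branch and `Q` is the lower
bound for `f`. Both survive gluing, as comparable members lie in the same piece. -/
theorem exists_isPruning_iUnion_of_forall {ι : Type*} {S M : ι → Set (List (L × D))}
    {T N : Set (List (L × D))} {Q : List (L × D) → List (L × D) → Prop}
    {R : List (L × D) → Prop} (hM : ∀ i, M i ⊆ S i)
    (hS : ∀ i j, ∀ s ∈ S i, ∀ s' ∈ S j, s <+: s' → i = j)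
    (h : ∀ i, ∃ θ e, IsPruning (S i) (M i) T N θ e ∧ (∀ t ∈ M i, R (e t)) ∧
      ∀ s ∈ S i, ∀ t ∈ M i, s <+: t → Q (θ s) (e t)) :
    ∃ θ e, IsPruning (⋃ i, S i) (⋃ i, M i) T N θ e ∧ (∀ t ∈ ⋃ i, M i, R (e t)) ∧
      ∀ s ∈ ⋃ i, S i, ∀ t ∈ ⋃ i, M i, s <+: t → Q (θ s) (e t) := by
  choose θ e hp hR hQ using h
  obtain ⟨Θ, E, H, hΘ, hE⟩ := exists_isPruning_iUnion hM hS hp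
  refine ⟨Θ, E, H, ?_, ?_⟩
  · intro t ht
    obtain ⟨i, hi⟩ := Set.mem_iUnion.1 ht
    rw [hE i t hi]
    exact hR i t hi
  · intro s hs t ht hst
    obtain ⟨i, hi⟩ := Set.mem_iUnion.1 hs
    obtain ⟨j, hj⟩ := Set.mem_iUnion.1 ht
    obtain rfl := hS i j s hi t (hM j hj) hst
    rw [hΘ i s hi, hE i t hj]
    exact hQ i s hi t hj hst

end Operations

/-- The inverse of `shiftD ζ` on its range. -/
noncomputable def unshiftD {D : Type v} (ζ : Ordinal.{u}) :
    List (Ordinal.{u} × D) → List (Ordinal.{u} × D) :=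
  Function.invFun (shiftD ζ)

theorem unshiftD_shiftD {D : Type v} (ζ : Ordinal.{u}) (s : List (Ordinal.{u} × D)) :
    unshiftD ζ (shiftD ζ s) = s :=
  Function.leftInverse_invFun (shiftD_injective ζ) s

theorem isPruning_unshiftD {D : Type v} [Preorder D] (ζ : Ordinal.{u})
    {S M : Set (List (Ordinal.{u} × D))} (hS : [] ∉ S) :
    IsPruning (shiftD ζ '' S) (shiftD ζ '' M) S M (unshiftD ζ) (unshiftD ζ) where
  mapsTo := by
    rintro _ ⟨s, hs, rfl⟩
    rwa [unshiftD_shiftD]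
  monotone := by
    rintro _ ⟨s, hs, rfl⟩ _ ⟨t, ht, rfl⟩ hp
    rw [unshiftD_shiftD, unshiftD_shiftD]
    exact (precedes_shiftD_iff ζ).1 hp
  lastLE := by
    rintro _ ⟨s, hs, rfl⟩
    rw [unshiftD_shiftD]
    have h : LastLE s s := LastLE.refl fun h => hS (h ▸ hs)
    simpa [shiftD] using h.shiftD ζ 0
  mapsTo_max := by
    rintro _ ⟨s, hs, rfl⟩
    rwa [unshiftD_shiftD]
  prefix_max := by
    rintro _ ⟨s, hs, rfl⟩ _ ⟨t, ht, rfl⟩ hp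
    rw [unshiftD_shiftD, unshiftD_shiftD]
    exact (shiftD_prefix_iff ζ).1 hp

/-! ### The transfinite induction on `ξ` -/

section Induction

variable {D : Type v} [Preorder D] {ξ : Ordinal.{u}}

/-- Translations suffice: Ω_η = Ω_{η,1} sits inside Ω_{η+1}, and for a limit `η > ζ` the tree
Ω_{ζ+1}, translated by `ω ^ ζ`, is a piece of Ω_η. -/
theorem exists_isPruning_Omega_of_le {ζ η : Ordinal.{u}} [Nonempty D] (h : ζ ≤ η) :
    ∃ x, IsPruning (Omega ζ D) (MAX (Omega ζ D)) (Omega η D) (MAX (Omega η D))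
      (shiftD x) (shiftD x) := by
  have self : ∃ x, IsPruning (Omega ζ D) (MAX (Omega ζ D)) (Omega ζ D) (MAX (Omega ζ D))
      (shiftD x) (shiftD x) := by
    refine ⟨0, ?_⟩
    have e : (shiftD 0 : List (Ordinal.{u} × D) → List (Ordinal.{u} × D)) = id := by
      funext t
      simp [shiftD]
    simpa [e] using isPruning_shiftD 0 (M := MAX (Omega ζ D)) (nil_notMem_Omega (ξ := ζ))
  have comp : ∀ {η η' : Ordinal.{u}} (y : Ordinal.{u}), shiftD y '' Omega η D ⊆ Omega η' D →
      shiftD y '' MAX (Omega η D) ⊆ MAX (Omega η' D) →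
      (∃ x, IsPruning (Omega ζ D) (MAX (Omega ζ D)) (Omega η D) (MAX (Omega η D))
        (shiftD x) (shiftD x)) →
      ∃ x, IsPruning (Omega ζ D) (MAX (Omega ζ D)) (Omega η' D) (MAX (Omega η' D))
        (shiftD x) (shiftD x) := by
    rintro η η' y h1 h2 ⟨x, hx⟩
    refine ⟨y + x, ?_⟩
    have e : (shiftD (y + x) : List (Ordinal.{u} × D) → List (Ordinal.{u} × D)) =
        shiftD y ∘ shiftD x := by
      funext t
      simp [shiftD, add_assoc]
    rw [e]
    exact ((isPruning_shiftD y nil_notMem_Omega).mono_right h1 h2).comp hx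
  induction η using Ordinal.limitRecOn with
  | zero =>
    obtain rfl : ζ = 0 := le_antisymm h (zero_le (a := ζ))
    exact self
  | add_one η ih =>
    rcases h.eq_or_lt with rfl | h
    · exact self
    · refine comp 0 ?_ ?_ (ih (Order.lt_add_one_iff.1 h))
      · have := OmegaN_one (ξ := η) (D := D)
        simp only [block, Nat.cast_zero, mul_zero] at this
        rw [← this, Omega_add_one]
        exact Set.subset_iUnion (fun n => OmegaN η (n + 1) D) 0
      · have := OmegaN_one (ξ := η) (D := D)
        simp only [block, Nat.cast_zero, mul_zero] at this
        rw [← MAX_shiftD, ← this, Omega_add_one, MAX_iUnion Omega_add_one_disjoint]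
        exact Set.subset_iUnion (fun n => MAX (OmegaN η (n + 1) D)) 0
  | limit η hη ih =>
    rcases h.eq_or_lt with rfl | h
    · exact self
    · have h' : ζ + 1 < η := hη.succ_lt h
      refine comp (ω ^ ζ) ?_ ?_ (ih (ζ + 1) h' (lt_add_one ζ).le)
      · rw [Omega_limit hη]
        exact Set.subset_iUnion (fun i : Set.Iio η => shiftD (ω ^ i.1) '' Omega (i.1 + 1) D) ⟨ζ, h⟩
      · rw [← MAX_shiftD, Omega_limit hη, MAX_iUnion Omega_limit_disjoint]
        exact Set.subset_iUnion
          (fun i : Set.Iio η => MAX (shiftD (ω ^ i.1) '' Omega (i.1 + 1) D)) ⟨ζ, h⟩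

/-- If at least `m` of the levels of `Ω_{ξ,n}` satisfy `G`, then `Ω_{ξ,m}` can be mapped into
these levels. -/
theorem exists_isPruning_OmegaN_of_le_count [Nonempty D] (G : ℕ → Prop) [DecidablePred G]
    (m n : ℕ) (h : m ≤ Nat.count G n) :
    ∃ θ e, IsPruning (OmegaN ξ m D) (branches ξ m D) (OmegaN ξ n D) (branches ξ n D) θ e ∧
      ∀ s ∈ OmegaN ξ m D, ∃ i, G i ∧ θ s ∈ Level ξ n (i + 1) D := by
  induction n generalizing m G with
  | zero =>
    obtain rfl : m = 0 := by simpa using h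
    refine ⟨id, id, ⟨fun _ h => h, fun _ h => absurd h (by simp [OmegaN_zero]),
      fun _ h => absurd h (by simp [OmegaN_zero]), fun _ h => h, fun _ _ _ _ h => h⟩,
      fun _ h => absurd h (by simp [OmegaN_zero])⟩
  | succ n ih =>
    rw [Nat.count_succ'] at h
    -- The bottom level is bypassed by placing everything above one fixed maximal member `t` of its
    -- block.
    have skip : m ≤ Nat.count (fun k => G (k + 1)) n → ∃ θ e, IsPruning (OmegaN ξ m D)
        (branches ξ m D) (OmegaN ξ (n + 1) D) (branches ξ (n + 1) D) θ e ∧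
        ∀ s ∈ OmegaN ξ m D, ∃ i, G i ∧ θ s ∈ Level ξ (n + 1) (i + 1) D := by
      intro h
      obtain ⟨θ, e, hp, hG⟩ := ih (fun k => G (k + 1)) m h
      obtain ⟨t, ht⟩ := MAX_block_nonempty (ξ := ξ) (D := D) n
      refine ⟨fun s => t ++ θ s, fun s => t ++ e s, ?_, fun s hs => ?_⟩
      · rw [OmegaN_succ, branches]
        exact hp.append_left ht
      · obtain ⟨i, hi, h⟩ := hG s hs
        refine ⟨i + 1, hi, ?_⟩
        rw [Level_succ]
        exact ⟨t, ht, _, h, rfl⟩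
    split_ifs at h with h0
    · cases m with
      | zero => exact skip (Nat.zero_le _)
      | succ m =>
        obtain ⟨θ, e, hp, hG⟩ := ih (fun k => G (k + 1)) m (by omega)
        have hb : IsPruning (block ξ m D) (MAX (block ξ m D)) (block ξ n D) (MAX (block ξ n D))
            (shiftD (ω ^ ξ * (n : Ordinal.{u})) ∘ unshiftD (ω ^ ξ * (m : Ordinal.{u})))
            (shiftD (ω ^ ξ * (n : Ordinal.{u})) ∘ unshiftD (ω ^ ξ * (m : Ordinal.{u}))) := by
          rw [MAX_block, MAX_block]
          exact (isPruning_shiftD _ nil_notMem_Omega).comp (isPruning_unshiftD _ nil_notMem_Omega)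
        obtain ⟨Θ, E, H, h1, h2, -⟩ := exists_isPruning_graft (θ := fun _ => θ) (e := fun _ => e)
          nil_notMem_OmegaN hb fun _ _ => hp
        rw [OmegaN_succ, OmegaN_succ, branches, branches]
        refine ⟨Θ, E, H, ?_⟩
        rintro _ (hs | ⟨t, ht, u, hu, rfl⟩)
        · refine ⟨0, h0, ?_⟩
          rw [h1 _ hs, Level_one]
          exact hb.mapsTo hs
        · obtain ⟨i, hi, h⟩ := hG u hu
          refine ⟨i + 1, hi, ?_⟩
          simp only [h2 t ht u hu, Level_succ]
          exact ⟨_, hb.mapsTo_max ht, _, h, rfl⟩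
    · exact skip (by simpa using h)

/-- Every `f` on the pairs of `Ω_ξ` can be pruned to lie above its averages along branches, and
every finite colouring of the branches can be made constant at the same time. -/
def Concentrates (ξ : Ordinal.{u}) (D : Type v) [Preorder D] : Prop :=
  ∀ (κ : Type) [Finite κ] (c : List (Ordinal.{u} × D) → κ)
    (f : List (Ordinal.{u} × D) → List (Ordinal.{u} × D) → ℝ) (δ : ℝ), 0 < δ →
    (∀ s ∈ Omega ξ D, ∀ t ∈ MAX (Omega ξ D), s <+: t → f s t ∈ Set.Icc (-1 : ℝ) 1) →
    ∃ θ e, IsPruning (Omega ξ D) (MAX (Omega ξ D)) (Omega ξ D) (MAX (Omega ξ D)) θ e ∧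
      ∃ k, (∀ t ∈ MAX (Omega ξ D), c (e t) = k) ∧
      ∀ s ∈ Omega ξ D, ∀ t ∈ MAX (Omega ξ D), s <+: t →
        avg ξ (fun r => f r (e t)) (e t) - δ ≤ f (θ s) (e t)

/-- A pruning of `Ω_{ξ,n}` that maps units into units and preserves levels. -/
structure IsLevelPruning (ξ : Ordinal.{u}) (n : ℕ)
    (θ e : List (Ordinal.{u} × D) → List (Ordinal.{u} × D)) : Prop where
  isPruning : IsPruning (OmegaN ξ n D) (branches ξ n D) (OmegaN ξ n D) (branches ξ n D) θ e
  unit_image : ∀ U : Set (List (Ordinal.{u} × D)), IsTreeUnit ξ n U →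
    ∃ V : Set (List (Ordinal.{u} × D)), IsTreeUnit ξ n V ∧ Set.MapsTo θ U V
  mapsTo_level : ∀ i, Set.MapsTo θ (Level ξ n i D) (Level ξ n i D)

/-- The analogue of `Concentrates` for `Ω_{ξ,n}`, with averages over each level. -/
def LevelConcentrates (ξ : Ordinal.{u}) (D : Type v) [Preorder D] (n : ℕ) : Prop :=
  ∀ (κ : Type) [Finite κ] (c : List (Ordinal.{u} × D) → κ)
    (f : List (Ordinal.{u} × D) → List (Ordinal.{u} × D) → ℝ) (δ : ℝ), 0 < δ →
    (∀ s ∈ OmegaN ξ n D, ∀ t ∈ branches ξ n D, s <+: t → f s t ∈ Set.Icc (-1 : ℝ) 1) →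
    ∃ θ e, IsLevelPruning ξ n θ e ∧
      ∃ k, (∀ t ∈ branches ξ n D, c (e t) = k) ∧
      ∀ i, ∀ s ∈ Level ξ n (i + 1) D, ∀ t ∈ branches ξ n D, s <+: t →
        levelAvg ξ n (i + 1) (fun r => f r (e t)) (e t) - δ ≤ f (θ s) (e t)

theorem levelConcentrates_zero : LevelConcentrates ξ D 0 := by
  intro κ _ c f δ _ _
  refine ⟨id, id, ⟨⟨fun _ h => h, fun _ h => absurd h (by simp [OmegaN_zero]),
    fun _ h => absurd h (by simp [OmegaN_zero]), fun _ h => h, fun _ _ _ _ h => h⟩,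
    fun U hU => absurd hU not_isTreeUnit_zero, fun _ _ h => h⟩, c [], ?_, ?_⟩
  · rintro _ rfl
    rfl
  · intro i s hs
    exact absurd hs.1 (by simp [OmegaN_zero])

/-- The part of `f` that pairs the first level of `Ω_{ξ,n+1}` with the branches through the
maximal member `s` of this level becomes, up to `ε`, independent of the branch. -/
theorem LevelConcentrates.exists_above [Nonempty D] {n : ℕ} (H : LevelConcentrates ξ D n)
    {κ : Type} [Finite κ] (c : List (Ordinal.{u} × D) → κ)
    {f : List (Ordinal.{u} × D) → List (Ordinal.{u} × D) → ℝ} {δ ε : ℝ} (hδ : 0 < δ) (hε : 0 < ε)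
    (hf : ∀ s ∈ OmegaN ξ (n + 1) D, ∀ t ∈ branches ξ (n + 1) D, s <+: t →
      f s t ∈ Set.Icc (-1 : ℝ) 1)
    {s : List (Ordinal.{u} × D)} (hs : s ∈ MAX (Omega ξ D)) :
    ∃ θ e k, ∃ g : List (Ordinal.{u} × D) → ℝ, IsLevelPruning ξ n θ e ∧
      (∀ u ∈ branches ξ n D, c (shiftD (ω ^ ξ * (n : Ordinal.{u})) s ++ e u) = k) ∧
      (∀ r ∈ Omega ξ D, r <+: s → g r ∈ Set.Icc (-1 : ℝ) 1 ∧ ∀ u ∈ branches ξ n D,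
        |f (shiftD (ω ^ ξ * (n : Ordinal.{u})) r)
          (shiftD (ω ^ ξ * (n : Ordinal.{u})) s ++ e u) - g r| ≤ ε) ∧
      ∀ i, ∀ r ∈ Level ξ n (i + 1) D, ∀ u ∈ branches ξ n D, r <+: u →
        levelAvg ξ n (i + 1) (fun r => f (shiftD (ω ^ ξ * (n : Ordinal.{u})) s ++ r)
          (shiftD (ω ^ ξ * (n : Ordinal.{u})) s ++ e u)) (e u) - δ ≤
        f (shiftD (ω ^ ξ * (n : Ordinal.{u})) s ++ θ r)
          (shiftD (ω ^ ξ * (n : Ordinal.{u})) s ++ e u) := by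
  set a : Ordinal.{u} := ω ^ ξ * (n : Ordinal.{u})
  have hw : shiftD a s ∈ MAX (block ξ n D) := by
    rw [MAX_block]
    exact ⟨s, hs, rfl⟩
  have hbr : ∀ u ∈ branches ξ n D, shiftD a s ++ u ∈ branches ξ (n + 1) D :=
    fun u hu => ⟨_, hw, u, hu, rfl⟩
  obtain ⟨κ', _, ρ, hρ⟩ := exists_rounding hε
  -- Besides `c`, the colour records the rounded value of `f` at each of the `s.length + 1` initial
  -- segments of `s`.
  obtain ⟨θ, e, hp, k, hk, hlow⟩ := H (κ × (Fin (s.length + 1) → κ'))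
    (fun u => (c (shiftD a s ++ u), fun j => ρ (f (shiftD a (s.take j)) (shiftD a s ++ u))))
    (fun r u => f (shiftD a s ++ r) (shiftD a s ++ u)) δ hδ (by
      intro r hr u hu hru
      refine hf _ ?_ _ (hbr u hu) ((List.prefix_append_right_inj _).2 hru)
      rw [OmegaN_succ]
      exact Or.inr ⟨_, hw, r, hr, rfl⟩)
  obtain ⟨u₀, hu₀⟩ := branches_nonempty (ξ := ξ) (D := D) n
  -- The branch `e u₀` serves as reference: `g r` is the value of `f` along it.
  refine ⟨θ, e, k.1, fun r => f (shiftD a r) (shiftD a s ++ e u₀), hp,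
    fun u hu => congrArg Prod.fst (hk u hu), ?_, hlow⟩
  intro r hr hrs
  have hmem : ∀ u ∈ branches ξ n D, f (shiftD a r) (shiftD a s ++ e u) ∈ Set.Icc (-1 : ℝ) 1 := by
    intro u hu
    refine hf _ ?_ _ (hbr _ (hp.isPruning.mapsTo_max hu))
      (((shiftD_prefix_iff a).2 hrs).trans (List.prefix_append _ _))
    rw [OmegaN_succ]
    exact Or.inl ⟨r, hr, rfl⟩
  refine ⟨hmem _ hu₀, fun u hu => hρ _ (hmem u hu) _ (hmem u₀ hu₀) ?_⟩
  have h := congrFun (congrArg Prod.snd ((hk u hu).trans (hk u₀ hu₀).symm))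
    ⟨r.length, Nat.lt_succ_of_le hrs.length_le⟩
  simpa only [← List.prefix_iff_eq_take.1 hrs] using h

/-- The upper levels are pruned before the first one. Each maximal `s` of Ω_ξ then carries a colour
`k s` and an approximation `g s` of `f` on the first level, which are the data for pruning Ω_ξ
itself. -/
theorem LevelConcentrates.succ [Nonempty D] {n : ℕ} (H₁ : Concentrates ξ D)
    (H : LevelConcentrates ξ D n) : LevelConcentrates ξ D (n + 1) := by
  intro κ _ c f δ hδ hf
  have : Nonempty κ := ⟨c []⟩
  -- Three errors on the first level: replacing `f` by `g` in the average, the concentration of `g`,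
  -- and returning from `g` to `f`.
  have hε : 0 < δ / 3 := by positivity
  choose! θ e k g hp hk hg hlow using fun s (hs : s ∈ MAX (Omega ξ D)) =>
    H.exists_above c hδ hε hf hs
  obtain ⟨θ₀, e₀, hp₀, K, hK, hlow₀⟩ := H₁ κ k (fun r s => g s r) (δ / 3) hε
    fun s hs t ht hst => (hg t ht s hs hst).1
  have hE' : branches ξ (n + 1) D = Set.image2 (· ++ ·) (MAX (block ξ n D)) (branches ξ n D) := rfl
  set a : Ordinal.{u} := ω ^ ξ * (n : Ordinal.{u})
  have hblock : block ξ n D = shiftD a '' Omega ξ D := rfl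
  have hMAX : MAX (block ξ n D) = shiftD a '' MAX (Omega ξ D) := MAX_block n
  have hb : IsPruning (block ξ n D) (MAX (block ξ n D)) (block ξ n D) (MAX (block ξ n D))
      (shiftD a ∘ θ₀ ∘ unshiftD a) (shiftD a ∘ e₀ ∘ unshiftD a) := by
    rw [hMAX, hblock]
    exact (isPruning_shiftD _ nil_notMem_Omega).comp
      (hp₀.comp (isPruning_unshiftD _ nil_notMem_Omega))
  -- The upper prunings are indexed by maximal members of Ω_ξ, whereas the graft uses the translated
  -- block; `unshiftD` converts.
  obtain ⟨Θ, E, hP, hΘ₁, hΘ₂, hE⟩ := exists_isPruning_graft (θ := fun w => θ (unshiftD a w))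
    (e := fun w => e (unshiftD a w)) (T := OmegaN ξ n D) (N := branches ξ n D)
    (T' := OmegaN ξ n D) (N' := branches ξ n D) nil_notMem_OmegaN hb (by
      rw [hMAX]
      rintro _ ⟨r, hr, rfl⟩
      rw [unshiftD_shiftD]
      exact (hp r hr).isPruning)
  have memMAX : ∀ {r}, r ∈ MAX (Omega ξ D) → shiftD a r ∈ MAX (block ξ n D) := by
    intro r hr
    rw [hMAX]
    exact ⟨r, hr, rfl⟩
  have hΘ₁' : ∀ r ∈ Omega ξ D, Θ (shiftD a r) = shiftD a (θ₀ r) := by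
    intro r hr
    rw [hΘ₁ (shiftD a r) ⟨r, hr, rfl⟩]
    simp only [Function.comp_apply, unshiftD_shiftD]
  have hΘ₂' : ∀ r ∈ MAX (Omega ξ D), ∀ u ∈ OmegaN ξ n D,
      Θ (shiftD a r ++ u) = shiftD a (e₀ r) ++ θ (e₀ r) u := by
    intro r hr u hu
    rw [hΘ₂ _ (memMAX hr) u hu]
    simp only [Function.comp_apply, unshiftD_shiftD]
  have hE'' : ∀ r ∈ MAX (Omega ξ D), ∀ u ∈ branches ξ n D,
      E (shiftD a r ++ u) = shiftD a (e₀ r) ++ e (e₀ r) u := by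
    intro r hr u hu
    rw [hE _ (memMAX hr) u hu]
    simp only [Function.comp_apply, unshiftD_shiftD]
  rw [← OmegaN_succ] at hP
  refine ⟨Θ, E, ⟨hP, ?_, ?_⟩, K, ?_, ?_⟩
  · intro U hU
    rcases isTreeUnit_succ.1 hU with rfl | ⟨t, ht, V, hV, rfl⟩
    · refine ⟨_, hU, ?_⟩
      rintro _ ⟨r, hr, rfl⟩
      rw [hΘ₁' r hr]
      exact ⟨_, hp₀.mapsTo hr, rfl⟩
    · rw [hMAX] at ht
      obtain ⟨r, hr, rfl⟩ := ht
      have hr' := hp₀.mapsTo_max hr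
      obtain ⟨W, hW, hVW⟩ := (hp _ hr').unit_image V hV
      refine ⟨_, isTreeUnit_succ.2 (Or.inr ⟨_, memMAX hr', W, hW, rfl⟩), ?_⟩
      rintro _ ⟨u, hu, rfl⟩
      simp only [hΘ₂' r hr u (hV.subset_OmegaN hu)]
      exact ⟨_, hVW hu, rfl⟩
  · rintro (_ | _ | i)
    · rw [Level_zero_right]
      exact fun _ h => h
    · rw [zero_add, Level_one, hblock]
      rintro _ ⟨r, hr, rfl⟩
      rw [hΘ₁' r hr]
      exact ⟨_, hp₀.mapsTo hr, rfl⟩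
    · rw [Level_succ]
      rw [hMAX]
      rintro _ ⟨_, ⟨r, hr, rfl⟩, u, hu, rfl⟩
      have hr' := hp₀.mapsTo_max hr
      simp only [hΘ₂' r hr u hu.1]
      exact ⟨_, ⟨_, hr', rfl⟩, _, (hp _ hr').mapsTo_level _ hu, rfl⟩
  · rw [hE', hMAX]
    rintro _ ⟨_, ⟨r, hr, rfl⟩, u, hu, rfl⟩
    simp only [hE'' r hr u hu]
    rw [hk _ (hp₀.mapsTo_max hr) u hu, hK r hr]
  · rw [hE', hMAX]
    rintro (_ | i)
    · rw [zero_add, Level_one, hblock]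
      rintro _ ⟨r', hr', rfl⟩ _ ⟨_, ⟨r, hr, rfl⟩, u, hu, rfl⟩ hst
      have hrr : r' <+: r :=
        (shiftD_prefix_iff a).1 (prefix_of_mem_MAX (memMAX hr) ⟨r', hr', rfl⟩ hst)
      have hm := hp₀.mapsTo_max hr
      simp only [hE'' r hr u hu, hΘ₁' r' hr']
      rw [levelAvg_one hm]
      have h1 := avg_le_avg_add hm hε.le (g := g (e₀ r))
        (f := fun s => f (shiftD a s) (shiftD a (e₀ r) ++ e (e₀ r) u)) fun s hs hsr => by
          have := (abs_le.1 ((hg _ hm s hs hsr).2 u hu)).2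
          linarith
      have h2 := hlow₀ r' hr' r hr hrr
      have h3 := (abs_le.1 ((hg _ hm _ (hp₀.mapsTo hr')
        (hp₀.prefix_max r' hr' r hr hrr)).2 u hu)).1
      linarith
    · rw [Level_succ]
      rw [hMAX]
      rintro _ ⟨_, ⟨r', hr', rfl⟩, s, hs, rfl⟩ _ ⟨_, ⟨r, hr, rfl⟩, u, hu, rfl⟩ hst
      obtain ⟨e₁, hsu⟩ := mem_MAX_append_inj (memMAX hr') (memMAX hr) hst
      obtain rfl := shiftD_injective a e₁
      have hm := hp₀.mapsTo_max hr
      simp only [hE'' r' hr u hu, hΘ₂' r' hr s hs.1]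
      rw [levelAvg_succ (memMAX hm)]
      exact hlow _ hm i s hs u hu hsu

theorem Concentrates.level [Nonempty D] (H : Concentrates ξ D) (n : ℕ) :
    LevelConcentrates ξ D n := by
  induction n with
  | zero => exact levelConcentrates_zero
  | succ n ih => exact ih.succ H

/-- Each member of Ω_0 is a single term and its own only branch, so the average is `f` itself and
only the colour needs work: a label `U` is raised to some `g U ≥ U` of the cofinal colour.
Directedness of `D` is used only here. -/
theorem concentrates_zero [IsDirectedOrder D] [Nonempty D] :
    Concentrates (0 : Ordinal.{u}) D := by
  intro κ _ c f δ hδ _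
  obtain ⟨k, hk⟩ := exists_cofinal_color fun U : D => c [(0, U)]
  choose g hg hgk using hk
  have key : ∀ s ∈ Omega 0 D, ∀ t ∈ Omega 0 D, s <+: t → s = t := by
    rw [Omega_zero]
    rintro _ ⟨U, rfl⟩ _ ⟨V, rfl⟩ h
    exact h.eq_of_length rfl
  have mem : ∀ s ∈ Omega (0 : Ordinal.{u}) D, s.map (fun p => (p.1, g p.2)) ∈ Omega 0 D := by
    rw [Omega_zero]
    rintro _ ⟨U, rfl⟩
    exact ⟨g U, rfl⟩
  simp only [MAX_Omega_zero]
  refine ⟨fun s => s.map fun p => (p.1, g p.2), fun s => s.map fun p => (p.1, g p.2),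
    ⟨fun s hs => mem s hs, ?_, ?_, fun s hs => mem s hs, ?_⟩, k, ?_, ?_⟩
  · intro s hs t ht h
    exact absurd (key s hs t ht h.1) h.2
  · rw [Omega_zero]
    rintro _ ⟨U, rfl⟩
    exact ⟨[], _, [], _, rfl, rfl, hg U⟩
  · intro s _ t _ h
    exact h.map _
  · rw [Omega_zero]
    rintro _ ⟨U, rfl⟩
    exact hgk U
  · intro s hs t ht hst
    obtain rfl := key s hs t ht hst
    have hm := mem s hs
    set y := s.map fun p => (p.1, g p.2)
    have h : avg 0 (fun r => f r y) y = f y y := by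
      classical
      rw [avg, branchSum, Finset.sum_eq_single y]
      · rw [P_zero, one_mul]
      · intro r hr hne
        simp only [Finset.mem_filter, List.mem_toFinset, List.mem_inits] at hr
        exact absurd (key r hr.2 y hm hr.1) hne
      · intro h
        exact absurd (by simpa using hm) h
    rw [h]
    linarith

/-- Among numbers `b i ≤ 1` with average `β ≥ -1`, a proportion of at least `ε / (2 + ε)` is at
least `β - ε`. -/
theorem mul_le_mul_count {n : ℕ} {b : ℕ → ℝ} {β ε : ℝ} [DecidablePred fun i => β - ε ≤ b i]
    (hb : ∀ i < n, b i ≤ 1) (hβ : -1 ≤ β) (h : ∑ i ∈ Finset.range n, b i = n * β) :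
    ε * n ≤ (2 + ε) * (Nat.count (fun i => β - ε ≤ b i) n : ℝ) := by
  -- For a good index the right side is `β + 2`, which is at least `1` as `β ≥ -1`.
  have h1 : ∑ i ∈ Finset.range n, b i ≤
      ∑ i ∈ Finset.range n, (β - ε + if β - ε ≤ b i then 2 + ε else 0) := by
    refine Finset.sum_le_sum fun i hi => ?_
    have := hb i (Finset.mem_range.1 hi)
    split_ifs <;> linarith
  rw [Finset.sum_add_distrib, Finset.sum_const, Finset.card_range, ← Finset.sum_filter,
    Finset.sum_const, _root_.nsmul_eq_mul, _root_.nsmul_eq_mul, h,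
    ← Nat.count_eq_card_filter_range] at h1
  linarith

/-- With the rounded level averages in the colour, the average of level `i + 1` stays within `ε` of
`b i`, and the overall average within `ε` above the mean `β`. The loss `4 * ε` consists of the
concentration error, these two deviations, and the margin in `β - ε ≤ b i`. -/
theorem LevelConcentrates.exists_good [Nonempty D] {n : ℕ} (H : LevelConcentrates ξ D (n + 1))
    {κ : Type} [Finite κ] (c : List (Ordinal.{u} × D) → κ)
    {f : List (Ordinal.{u} × D) → List (Ordinal.{u} × D) → ℝ} {ε : ℝ} (hε : 0 < ε)
    (hf : ∀ s ∈ OmegaN ξ (n + 1) D, ∀ t ∈ branches ξ (n + 1) D, s <+: t →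
      f s t ∈ Set.Icc (-1 : ℝ) 1) :
    ∃ θ e, IsLevelPruning ξ (n + 1) θ e ∧
      ∃ k, ∃ G : ℕ → Prop, ∃ _ : DecidablePred G, (∀ t ∈ branches ξ (n + 1) D, c (e t) = k) ∧
      ε * (n + 1 : ℕ) ≤ (2 + ε) * (Nat.count G (n + 1) : ℝ) ∧
      ∀ i, G i → ∀ s ∈ Level ξ (n + 1) (i + 1) D, ∀ t ∈ branches ξ (n + 1) D, s <+: t →
        avg (ξ + 1) (fun r => f r (e t)) (e t) - 4 * ε ≤ f (θ s) (e t) := by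
  classical
  obtain ⟨κ', _, ρ, hρ⟩ := exists_rounding hε
  obtain ⟨θ, e, hp, k, hk, hlow⟩ := H (κ × (Fin (n + 1) → κ'))
    (fun t => (c t, fun i => ρ (levelAvg ξ (n + 1) (i + 1) (fun r => f r t) t))) f ε hε hf
  obtain ⟨t₀, ht₀⟩ := branches_nonempty (ξ := ξ) (D := D) (n + 1)
  set b : ℕ → ℝ := fun i => levelAvg ξ (n + 1) (i + 1) (fun r => f r (e t₀)) (e t₀)
  set β : ℝ := (∑ i ∈ Finset.range (n + 1), b i) / (n + 1 : ℕ)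
  have hn : (0 : ℝ) < (n + 1 : ℕ) := by positivity
  have hmem : ∀ i < n + 1, ∀ t ∈ branches ξ (n + 1) D,
      levelAvg ξ (n + 1) (i + 1) (fun r => f r (e t)) (e t) ∈ Set.Icc (-1 : ℝ) 1 :=
    fun i hi t ht => levelAvg_mem_Icc hi (hp.isPruning.mapsTo_max ht) fun s hs hst =>
      hf s hs _ (hp.isPruning.mapsTo_max ht) hst
  have hclose : ∀ i < n + 1, ∀ t ∈ branches ξ (n + 1) D,
      |levelAvg ξ (n + 1) (i + 1) (fun r => f r (e t)) (e t) - b i| ≤ ε := fun i hi t ht =>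
    hρ _ (hmem i hi t ht) _ (hmem i hi t₀ ht₀)
      (congrFun (congrArg Prod.snd ((hk t ht).trans (hk t₀ ht₀).symm)) ⟨i, hi⟩)
  refine ⟨θ, e, hp, k.1, fun i => β - ε ≤ b i, inferInstance,
    fun t ht => congrArg Prod.fst (hk t ht), ?_, ?_⟩
  · refine mul_le_mul_count (fun i hi => (hmem i hi t₀ ht₀).2) ?_ (mul_div_cancel₀ _ hn.ne').symm
    rw [le_div_iff₀ hn]
    have := Finset.card_nsmul_le_sum (Finset.range (n + 1)) b (-1)
      fun i hi => (hmem i (Finset.mem_range.1 hi) t₀ ht₀).1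
    rw [Finset.card_range, _root_.nsmul_eq_mul] at this
    linarith
  · intro i hi s hs t ht hst
    have hi' : i < n + 1 := hs.2.2.1
    have h1 := hlow i s hs t ht hst
    have h2 := (abs_le.1 (hclose i hi' t ht)).1
    have h3 : avg (ξ + 1) (fun r => f r (e t)) (e t) ≤ β + ε := by
      have het := hp.isPruning.mapsTo_max ht
      rw [← MAX_OmegaN] at het
      rw [avg_add_one het.1, one_div, inv_mul_le_iff₀ hn]
      calc _ ≤ ∑ i ∈ Finset.range (n + 1), (b i + ε) := Finset.sum_le_sum fun i hi => by
            have := (abs_le.1 (hclose i (Finset.mem_range.1 hi) t ht)).2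
            linarith
        _ = (n + 1 : ℕ) * (β + ε) := by
            rw [Finset.sum_add_distrib, Finset.sum_const, Finset.card_range,
              _root_.nsmul_eq_mul, mul_add, mul_div_cancel₀ _ hn.ne']
    linarith

/-- Each Ω_{ξ,m+1} goes into the good levels of some Ω_{ξ,n+1} whose colour is the cofinal one.
Levels change their positions, which is harmless because `Concentrates` does not ask for levels to
be preserved. -/
theorem Concentrates.add_one [Nonempty D] (H : Concentrates ξ D) : Concentrates (ξ + 1) D := by
  intro κ _ c f δ hδ hf
  have hε : 0 < δ / 4 := by positivity
  have hMAX : MAX (Omega (ξ + 1) D) = ⋃ n : ℕ, MAX (OmegaN ξ (n + 1) D) := by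
    rw [Omega_add_one, MAX_iUnion Omega_add_one_disjoint]
  have sub : ∀ n, OmegaN ξ (n + 1) D ⊆ Omega (ξ + 1) D := by
    rw [Omega_add_one]
    exact Set.subset_iUnion fun n => OmegaN ξ (n + 1) D
  have sub' : ∀ n, branches ξ (n + 1) D ⊆ MAX (Omega (ξ + 1) D) := by
    intro n
    rw [hMAX, ← MAX_OmegaN]
    exact Set.subset_iUnion (fun n => MAX (OmegaN ξ (n + 1) D)) n
  choose θ e hp k G hdec hk hG hlow using fun n => (H.level (n + 1)).exists_good c hε
    fun s hs t ht hst => hf s (sub n hs) t (sub' n ht) hst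
  obtain ⟨K, hK⟩ := exists_cofinal_color k
  have key := exists_isPruning_iUnion_of_forall (S := fun n : ℕ => OmegaN ξ (n + 1) D)
    (M := fun n : ℕ => MAX (OmegaN ξ (n + 1) D)) (T := Omega (ξ + 1) D)
    (N := MAX (Omega (ξ + 1) D)) (R := fun t => c t = K)
    (Q := fun s t => avg (ξ + 1) (fun r => f r t) t - δ ≤ f s t) (fun _ _ h => h.1)
    Omega_add_one_disjoint ?_
  · rw [← Omega_add_one, ← hMAX] at key
    obtain ⟨θ, e, h, hR, hQ⟩ := key
    exact ⟨θ, e, h, K, hR, hQ⟩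
  · intro m
    -- With `ε = δ / 4`, this `N` makes the guaranteed count `ε * (n + 1) / (2 + ε)` at least `m +
    -- 1` whenever `n ≥ N`.
    obtain ⟨N, hN⟩ := exists_nat_ge ((2 + δ / 4) * (m + 1 : ℕ) / (δ / 4))
    obtain ⟨n, hn, hnK⟩ := hK N
    have hcount : m + 1 ≤ Nat.count (G n) (n + 1) := by
      rw [div_le_iff₀ hε] at hN
      have h1 : (N : ℝ) ≤ (n + 1 : ℕ) := by exact_mod_cast hn.trans n.le_succ
      have h2 := mul_le_mul_of_nonneg_left h1 hε.le
      have h3 := hG n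
      have h4 : (2 + δ / 4) * ((m + 1 : ℕ) : ℝ) ≤
          (2 + δ / 4) * (Nat.count (G n) (n + 1) : ℝ) := by linarith
      exact_mod_cast le_of_mul_le_mul_left h4 (by positivity)
    obtain ⟨θ', e', hp', hG'⟩ :=
      exists_isPruning_OmegaN_of_le_count (ξ := ξ) (D := D) (G n) (m + 1) (n + 1) hcount
    simp only [MAX_OmegaN]
    refine ⟨θ n ∘ θ', e n ∘ e', ((hp n).isPruning.comp hp').mono_right (sub n) (sub' n), ?_, ?_⟩
    · intro t ht
      rw [← hnK]
      exact hk n _ (hp'.mapsTo_max ht)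
    · intro s hs t ht hst
      obtain ⟨i, hi, h⟩ := hG' s hs
      have := hlow n i hi _ h _ (hp'.mapsTo_max ht) (hp'.prefix_max s hs t ht hst)
      simp only [Function.comp_apply]
      linarith

/-- The piece of index `ζ` is translated into one of index `η ≥ ζ` with the cofinal colour, and then
pruned there. The average refers to the target branch, so only the weights of the piece `η` matter.
-/
theorem concentrates_limit [Nonempty D] (hξ : Order.IsSuccLimit ξ)
    (H : ∀ ζ < ξ, Concentrates (ζ + 1) D) : Concentrates ξ D := by
  intro κ _ c f δ hδ hf
  have hΩ := Omega_limit (D := D) hξ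
  have hMAX : MAX (Omega ξ D) = ⋃ ζ : Set.Iio ξ, shiftD (ω ^ ζ.1) '' MAX (Omega (ζ.1 + 1) D) := by
    rw [hΩ, MAX_iUnion Omega_limit_disjoint]
    simp only [MAX_shiftD]
  have sub : ∀ ζ : Set.Iio ξ, shiftD (ω ^ ζ.1) '' Omega (ζ.1 + 1) D ⊆ Omega ξ D := by
    rw [hΩ]
    exact Set.subset_iUnion fun ζ : Set.Iio ξ => shiftD (ω ^ ζ.1) '' Omega (ζ.1 + 1) D
  have sub' : ∀ ζ : Set.Iio ξ,
      shiftD (ω ^ ζ.1) '' MAX (Omega (ζ.1 + 1) D) ⊆ MAX (Omega ξ D) := by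
    rw [hMAX]
    exact Set.subset_iUnion fun ζ : Set.Iio ξ => shiftD (ω ^ ζ.1) '' MAX (Omega (ζ.1 + 1) D)
  choose θ e hp k hk hlow using fun ζ : Set.Iio ξ => H ζ.1 ζ.2 κ (fun t => c (shiftD (ω ^ ζ.1) t))
    (fun s t => f (shiftD (ω ^ ζ.1) s) (shiftD (ω ^ ζ.1) t)) δ hδ fun s hs t ht hst =>
      hf _ (sub ζ ⟨s, hs, rfl⟩) _ (sub' ζ ⟨t, ht, rfl⟩) ((shiftD_prefix_iff _).2 hst)
  have : Nonempty (Set.Iio ξ) := ⟨⟨0, hξ.pos⟩⟩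
  obtain ⟨K, hK⟩ := exists_cofinal_color k
  have key := exists_isPruning_iUnion_of_forall
    (S := fun ζ : Set.Iio ξ => shiftD (ω ^ ζ.1) '' Omega (ζ.1 + 1) D)
    (M := fun ζ : Set.Iio ξ => shiftD (ω ^ ζ.1) '' MAX (Omega (ζ.1 + 1) D)) (T := Omega ξ D)
    (N := MAX (Omega ξ D)) (R := fun t => c t = K)
    (Q := fun s t => avg ξ (fun r => f r t) t - δ ≤ f s t)
    (fun _ => Set.image_mono fun _ h => h.1) Omega_limit_disjoint ?_
  · rw [← hΩ, ← hMAX] at key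
    obtain ⟨θ, e, h, hR, hQ⟩ := key
    exact ⟨θ, e, h, K, hR, hQ⟩
  · intro ζ
    obtain ⟨η, hη, hηK⟩ := hK ζ
    obtain ⟨x, hx⟩ := exists_isPruning_Omega_of_le (D := D) (ζ := ζ.1 + 1) (η := η.1 + 1)
      (add_le_add_left (show ζ.1 ≤ η.1 from hη) 1)
    have h₁ := hx.comp (isPruning_unshiftD (ω ^ ζ.1) nil_notMem_Omega)
    refine ⟨_, _, (((isPruning_shiftD (ω ^ η.1) nil_notMem_Omega).comp (hp η)).comp
      h₁).mono_right (sub η) (sub' η), ?_, ?_⟩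
    · intro t ht
      rw [← hηK]
      exact hk η _ (h₁.mapsTo_max ht)
    · intro s hs t ht hst
      have h := hlow η _ (h₁.mapsTo hs) _ (h₁.mapsTo_max ht) (h₁.prefix_max s hs t ht hst)
      rw [← avg_limit hξ η.2 ((hp η).mapsTo_max (h₁.mapsTo_max ht)).1
        (fun r => f r (shiftD (ω ^ η.1) (e η ((shiftD x ∘ unshiftD (ω ^ ζ.1)) t))))] at h
      exact h

theorem concentrates [IsDirectedOrder D] [Nonempty D] (ξ : Ordinal.{u}) : Concentrates ξ D := by
  induction ξ using Ordinal.limitRecOn with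
  | zero => exact concentrates_zero
  | add_one ξ ih => exact ih.add_one
  | limit ξ hξ ih => exact concentrates_limit hξ fun ζ hζ => ih _ (hξ.succ_lt hζ)

end Induction

/-! ### Deduction of the two assertions -/

section Main

variable {D : Type v} [Preorder D] {ξ : Ordinal.{u}} {n : ℕ}
  {θ e : List (Ordinal.{u} × D) → List (Ordinal.{u} × D)}

theorem IsLevelPruning.isUnitPreserving [Nonempty D] (hn : 1 ≤ n) (h : IsLevelPruning ξ n θ e) :
    IsUnitPreserving ξ n θ e where
  extendedPruning :=
    { mapsTo := h.isPruning.mapsTo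
      monotone := h.isPruning.monotone
      label_le := by
        intro s₁ ζ U s₂ ζ' U' hs e₁
        obtain ⟨s₀, p, t₀, q, hp, hq, hpq⟩ := h.isPruning.lastLE _ hs
        rw [e₁] at hq
        rw [← List.singleton_inj.1 (List.append_inj' hp rfl).2,
          ← List.singleton_inj.1 (List.append_inj' hq rfl).2] at hpq
        exact hpq
      mapsTo_max := by
        have := h.isPruning.mapsTo_max
        rwa [branches_eq_MAX hn] at this
      prefix_max := fun t ht => h.isPruning.prefix_max t ht.1 t
        (by rwa [branches_eq_MAX hn]) (List.prefix_refl t) }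
  unit_image := h.unit_image
  level_ne s t _ i j hs ht hij k l hk hl := by
    rw [Level_disjoint hk (h.mapsTo_level i hs), Level_disjoint hl (h.mapsTo_level j ht)]
    exact hij

theorem sum_Icc_one_eq_sum_range (a : ℕ → ℝ) (n : ℕ) :
    ∑ i ∈ Finset.Icc 1 n, a i = ∑ i ∈ Finset.range n, a (i + 1) := by
  induction n with
  | zero => simp
  | succ n ih => rw [Finset.sum_Icc_succ_top (by omega), Finset.sum_range_succ, ih]

theorem exists_isUnitPreserving_sum_le [IsDirectedOrder D] [Nonempty D] (ξ : Ordinal.{u})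
    (hn : 1 ≤ n) {δ : ℝ} (hδ : 0 < δ) {f : List (Ordinal.{u} × D) → List (Ordinal.{u} × D) → ℝ}
    (hf : ∀ s t, (s, t) ∈ PiSet (OmegaN ξ n D) → f s t ∈ Set.Icc (-1 : ℝ) 1) :
    ∃ (θ e : List (Ordinal.{u} × D) → List (Ordinal.{u} × D)) (a : ℕ → ℝ),
      IsUnitPreserving ξ n θ e ∧
      (∀ i ∈ Finset.Icc 1 n,
        a i ∈ Set.Icc (-1 : ℝ) 1 ∧
        (∀ s ∈ Level ξ n i D, ∀ t ∈ MAX (OmegaN ξ n D), s <+: t →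
          a i - δ ≤ f (θ s) (e t)) ∧
        (∀ t ∈ MAX (OmegaN ξ n D),
          branchSum (Level ξ n i D) (e t) (fun s => P ξ (iota ξ n s) * f s (e t))
            ≤ δ / n + a i)) ∧
      (∀ t ∈ MAX (OmegaN ξ n D),
        branchSum (OmegaN ξ n D) (e t) (fun s => P ξ (iota ξ n s) * f s (e t))
          ≤ δ + ∑ i ∈ Finset.Icc 1 n, a i) := by
  have hn0 : (0 : ℝ) < n := by exact_mod_cast hn
  -- The lower bound loses one concentration and one rounding error, together `δ / n ≤ δ`; the upper
  -- bound loses one rounding error.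
  have hε : 0 < δ / n / 2 := by positivity
  have hεδ : δ / n ≤ δ := div_le_self hδ.le (by exact_mod_cast hn)
  have hbr := branches_eq_MAX (ξ := ξ) (D := D) hn
  have hf' : ∀ s ∈ OmegaN ξ n D, ∀ t ∈ branches ξ n D, s <+: t → f s t ∈ Set.Icc (-1 : ℝ) 1 :=
    fun s hs t ht hst => hf s t ⟨hs, hbr ▸ ht, hst⟩
  obtain ⟨κ, _, ρ, hρ⟩ := exists_rounding hε
  obtain ⟨θ, e, hp, k, hk, hlow⟩ := (concentrates (D := D) ξ).level n (Fin n → κ)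
    (fun t i => ρ (levelAvg ξ n (i + 1) (fun r => f r t) t)) f (δ / n / 2) hε hf'
  obtain ⟨t₀, ht₀⟩ := branches_nonempty (ξ := ξ) (D := D) n
  have hmem : ∀ i < n, ∀ t ∈ branches ξ n D,
      levelAvg ξ n (i + 1) (fun r => f r (e t)) (e t) ∈ Set.Icc (-1 : ℝ) 1 :=
    fun i hi t ht => levelAvg_mem_Icc hi (hp.isPruning.mapsTo_max ht) fun s hs hst =>
      hf' s hs _ (hp.isPruning.mapsTo_max ht) hst
  have hclose : ∀ i < n, ∀ t ∈ branches ξ n D,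
      |levelAvg ξ n (i + 1) (fun r => f r (e t)) (e t) -
        levelAvg ξ n (i + 1) (fun r => f r (e t₀)) (e t₀)| ≤ δ / n / 2 := fun i hi t ht =>
    hρ _ (hmem i hi t ht) _ (hmem i hi t₀ ht₀)
      (congrFun ((hk t ht).trans (hk t₀ ht₀).symm) ⟨i, hi⟩)
  have hhigh : ∀ i < n, ∀ t ∈ branches ξ n D,
      levelAvg ξ n (i + 1) (fun r => f r (e t)) (e t) ≤
        δ / n + levelAvg ξ n (i + 1) (fun r => f r (e t₀)) (e t₀) := by
    intro i hi t ht
    have := (abs_le.1 (hclose i hi t ht)).2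
    linarith
  -- The numbers `a i` are the level averages along the reference branch `e t₀`.
  refine ⟨θ, e, fun i => levelAvg ξ n i (fun r => f r (e t₀)) (e t₀), hp.isUnitPreserving hn,
    ?_, ?_⟩
  · intro i hi
    rw [Finset.mem_Icc] at hi
    obtain ⟨i, rfl⟩ := Nat.exists_eq_add_of_le' hi.1
    have hi' : i < n := hi.2
    rw [← hbr]
    refine ⟨hmem i hi' t₀ ht₀, ?_, hhigh i hi'⟩
    intro s hs t ht hst
    have h1 := hlow i s hs t ht hst
    have h2 := (abs_le.1 (hclose i hi' t ht)).1
    linarith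
  · intro t ht
    rw [← hbr] at ht
    rw [branchSum_OmegaN, sum_Icc_one_eq_sum_range]
    calc _ ≤ ∑ i ∈ Finset.range n,
          (δ / n + levelAvg ξ n (i + 1) (fun r => f r (e t₀)) (e t₀)) :=
          Finset.sum_le_sum fun i hi => hhigh i (Finset.mem_range.1 hi) t ht
      _ = _ := by
          rw [Finset.sum_add_distrib, Finset.sum_const, Finset.card_range, _root_.nsmul_eq_mul,
            mul_div_cancel₀ _ hn0.ne']

theorem exists_isUnitPreserving_lt_sum [IsDirectedOrder D] [Nonempty D] (ξ : Ordinal.{u})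
    (hn : 1 ≤ n) {b b₁ M : ℝ} (hb : b < b₁)
    {f : List (Ordinal.{u} × D) → List (Ordinal.{u} × D) → ℝ}
    (hM : ∀ s t, (s, t) ∈ PiSet (OmegaN ξ n D) → |f s t| ≤ M)
    (hf : ∀ t ∈ MAX (OmegaN ξ n D),
      b₁ ≤ branchSum (OmegaN ξ n D) t (fun s => P ξ (iota ξ n s) * f s t)) :
    ∃ (θ e : List (Ordinal.{u} × D) → List (Ordinal.{u} × D)) (a : ℕ → ℝ),
      IsUnitPreserving ξ n θ e ∧
      b < ∑ i ∈ Finset.Icc 1 n, a i ∧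
      (∀ i ∈ Finset.Icc 1 n, ∀ s ∈ Level ξ n i D, ∀ t ∈ MAX (OmegaN ξ n D), s <+: t →
        a i ≤ f (θ s) (e t)) := by
  set K : ℝ := max M 1
  have hK : 0 < K := lt_of_lt_of_le one_pos (le_max_right M 1)
  -- After rescaling by `K`, passing to the sum costs `K * δ`, and lowering each of the `n` numbers
  -- by `δ` costs `n * K * δ`. The total is half of `b₁ - b`.
  set δ : ℝ := (b₁ - b) / (2 * K * (n + 1))
  have hδ : 0 < δ := div_pos (sub_pos.2 hb) (by positivity)
  have hδ' : K * δ * (n + 1) = (b₁ - b) / 2 := by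
    simp only [δ]
    field_simp
  obtain ⟨θ, e, a, hp, ha, hsum⟩ := exists_isUnitPreserving_sum_le (D := D) ξ hn hδ
    (f := fun s t => K⁻¹ * f s t) fun s t h => by
      rw [Set.mem_Icc, ← abs_le, abs_mul, abs_of_pos (inv_pos.2 hK), inv_mul_le_iff₀ hK, mul_one]
      exact (hM s t h).trans (le_max_left M 1)
  refine ⟨θ, e, fun i => K * (a i - δ), hp, ?_, ?_⟩
  · obtain ⟨t, ht⟩ := branches_nonempty (ξ := ξ) (D := D) n
    rw [branches_eq_MAX hn] at ht
    have h1 := hsum t ht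
    have h2 := hf _ (hp.extendedPruning.mapsTo_max ht)
    simp only [mul_left_comm _ K⁻¹] at h1
    rw [branchSum_mul_left, inv_mul_le_iff₀ hK] at h1
    rw [← Finset.mul_sum, Finset.sum_sub_distrib, Finset.sum_const, Nat.card_Icc,
      Nat.add_sub_cancel, _root_.nsmul_eq_mul]
    linarith
  · intro i hi s hs t ht hst
    have := (ha i hi).2.1 s hs t ht hst
    rwa [le_inv_mul_iff₀ hK] at this

theorem isUnitPreserving_id [IsEmpty D] :
    IsUnitPreserving ξ n (id : List (Ordinal.{u} × D) → List (Ordinal.{u} × D)) id where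
  extendedPruning :=
    { mapsTo := fun _ h => h
      monotone := fun _ _ _ _ h => h
      label_le := fun _ _ U => isEmptyElim U
      mapsTo_max := fun _ h => h
      prefix_max := fun t _ => List.prefix_refl t }
  unit_image U hU := ⟨U, hU, fun _ h => h⟩
  level_ne s t _ i j hs := by
    have h := hs.1
    rw [OmegaN_eq_empty] at h
    exact h.elim

end Main

end BTree

open BTree
theorem mainTheorem4 {D : Type v} [Preorder D] [IsDirectedOrder D]
    (ξ : Ordinal.{u}) (n : ℕ) (hn : 1 ≤ n) :
    (∀ (δ : ℝ), 0 < δ → δ < 1 →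
      ∀ f : List (Ordinal.{u} × D) → List (Ordinal.{u} × D) → ℝ,
      (∀ s t, (s, t) ∈ PiSet (OmegaN ξ n D) → f s t ∈ Set.Icc (-1 : ℝ) 1) →
      ∃ (θ e : List (Ordinal.{u} × D) → List (Ordinal.{u} × D)) (a : ℕ → ℝ),
        IsUnitPreserving ξ n θ e ∧
        (∀ i ∈ Finset.Icc 1 n,
          a i ∈ Set.Icc (-1 : ℝ) 1 ∧
          (∀ s ∈ Level ξ n i D, ∀ t ∈ MAX (OmegaN ξ n D), s <+: t →
            a i - δ ≤ f (θ s) (e t)) ∧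
          (∀ t ∈ MAX (OmegaN ξ n D),
            branchSum (Level ξ n i D) (e t) (fun s => P ξ (iota ξ n s) * f s (e t))
              ≤ δ / n + a i)) ∧
        (∀ t ∈ MAX (OmegaN ξ n D),
          branchSum (OmegaN ξ n D) (e t) (fun s => P ξ (iota ξ n s) * f s (e t))
            ≤ δ + ∑ i ∈ Finset.Icc 1 n, a i)) ∧
    (∀ (b b₁ : ℝ), b < b₁ →
      ∀ f : List (Ordinal.{u} × D) → List (Ordinal.{u} × D) → ℝ,
      (∃ M : ℝ, ∀ s t, (s, t) ∈ PiSet (OmegaN ξ n D) → |f s t| ≤ M) →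
      (∀ t ∈ MAX (OmegaN ξ n D),
        b₁ ≤ branchSum (OmegaN ξ n D) t (fun s => P ξ (iota ξ n s) * f s t)) →
      ∃ (θ e : List (Ordinal.{u} × D) → List (Ordinal.{u} × D)) (a : ℕ → ℝ),
        IsUnitPreserving ξ n θ e ∧
        b < ∑ i ∈ Finset.Icc 1 n, a i ∧
        (∀ i ∈ Finset.Icc 1 n, ∀ s ∈ Level ξ n i D, ∀ t ∈ MAX (OmegaN ξ n D), s <+: t →
          a i ≤ f (θ s) (e t))) := by
  -- Without labels there are no branches and hence no reference branch. All conditions on `f` are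
  -- vacuous, and `|b| + 1` is large enough for the sum to exceed `b`, since `n ≥ 1`.
  rcases isEmpty_or_nonempty D with hD | hD
  · have h0 : ∀ t, t ∉ MAX (OmegaN ξ n D) := fun t ht => by
      have h := ht.1
      rw [OmegaN_eq_empty] at h
      exact h
    refine ⟨fun δ _ _ f _ => ⟨id, id, fun _ => 0, isUnitPreserving_id, fun i _ =>
      ⟨by simp, fun _ _ t ht => absurd ht (h0 t), fun t ht => absurd ht (h0 t)⟩,
      fun t ht => absurd ht (h0 t)⟩, fun b b₁ _ f _ _ => ⟨id, id, fun _ => |b| + 1,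
      isUnitPreserving_id, ?_, fun _ _ _ _ t ht => absurd ht (h0 t)⟩⟩
    rw [Finset.sum_const, Nat.card_Icc, Nat.add_sub_cancel, nsmul_eq_mul]
    have h1 : (1 : ℝ) ≤ n := by exact_mod_cast hn
    nlinarith [le_abs_self b, abs_nonneg b]
  · exact ⟨fun δ hδ _ f hf => exists_isUnitPreserving_sum_le ξ hn hδ hf,
      fun b b₁ hb f ⟨_, hM⟩ hf => exists_isUnitPreserving_lt_sum ξ hn hb hM hf⟩
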